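/- A weight sequence is a sequence $(M_p)_{p\in\mathbb{N}}$ of positive numbers with $M_0=1$ and $M_{p+1}/M_p\to\infty$. It satisfies (lc) if $M_p^2\le M_{p-1}M_{p+1}$ for all $p\ge 1$, and (dc) if there are $C_0,H\ge 1$ with $M_{p+1}\le C_0H^{p+1}M_p$ for all $p\in\mathbb{N}$. Its 2-interpolating sequence $(N_p)$ is $N_{2q}=M_q$, $N_{2q+1}=(M_qM_{q+1})^{1/2}$, $q\in\mathbb{N}$. For $h>0$ let $\Lambda_{M_p,h}$ be the Banach space of all $a\in\mathbb{C}^{\mathbb{N}}$ with $\sup_p h^p|a_p|/M_p<\infty$, and set $\Lambda_{(M_p)}=\varprojlim_{h\to\infty}\Lambda_{M_p,h}$, $\Lambda_{\{M_p\}}=\varinjlim_{h\to0^+}\Lambda_{M_p,h}$. For $n\in\mathbb{N}$, $h>0$ let $\mathcal{S}^n_{M_p,h}(\mathbb{R})$ be the Banach space of all $\varphi\in C^n(\mathbb{R})$ (complex-valued) with norm $$\max_{m\le n}\sup_{p\in\mathbb{N}}\sup_{x\in\mathbb{R}}\frac{h^p|x^p\varphi^{(m)}(x)|}{M_p}<\infty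 ,$$ and let $\mathcal{S}^n_{M_p,h}(0,\infty)$ and $\mathcal{S}^{n,0}_{M_p,h}(\mathbb{R})$ be its closed subspaces of those $\varphi$ with $\operatorname{supp}\varphi\subseteq[0,\infty)$, respectively with $\varphi^{(m)}(0)=0$ for all $m\le n$. Set $$\mathcal{S}_{(M_p)}(0,\infty)=\varprojlim_{n\to\infty}\mathcal{S}^n_{M_p,n}(0,\infty),\quad \overrightarrow{\mathcal{S}}_{\{M_p\}}(0,\infty)=\varinjlim_{h\to0^+}\varprojlim_{n\to\infty}\mathcal{S}^n_{M_p,h}(0,\infty),\quad \overleftarrow{\mathcal{S}}_{\{M_p\}}(0,\infty)=\varprojlim_{n\to\infty}\varinjlim_{h\to0^+}\mathcal{S}^n_{M_p,h}(0,\infty),$$ and define $\mathcal{S}^0_{(M_p)}(\mathbb{R})$, $\overrightarrow{\mathcal{S}}^0_{\{M_p\}}(\mathbb{R})$, $\overleftarrow{\mathcal{S}}^0_{\{M_p\}}(\mathbb{R})$ in the same way from the spaces $\mathcal{S}^{n,0}_{M_p,h}(\mathbb{R})$. Projective limits carry the coarsest topology making the inclusions into the steps continuous, inductive limits the finest locally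 convex topology making the inclusions of the steps continuous. Under (dc) the moment mapping $\mathcal{M}(\varphi)=\big(\int_{-\infty}^\infty x^p\varphi(x)\,dx\big)_{p\in\mathbb{N}}$ maps the Beurling spaces into $\Lambda_{(M_p)}$ and the Roumieu spaces into $\Lambda_{\{M_p\}}$. **Proposition.** Let $(M_p)_{p\in\mathbb{N}}$ be a weight sequence satisfying (lc) and (dc), and let $(N_p)_{p\in\mathbb{N}}$ be its 2-interpolating sequence (which is again a weight sequence satisfying (dc)). (a) $\mathcal{M}:\mathcal{S}_{(M_p)}(0,\infty)\to\Lambda_{(M_p)}$ is surjective (resp. has a continuous linear right inverse) if and only if $\mathcal{M}:\mathcal{S}^0_{(N_p)}(\mathbb{R})\to\Lambda_{(N_p)}$ is surjective (resp. has a continuous linear right inverse). (b) If $\mathcal{M}:\overrightarrow{\mathcal{S}}^0_{\{N_p\}}(\mathbb{R})\to\Lambda_{\{N_p\}}$ is surjective (resp. has a continuous linear right inverse), then so is (resp. does) $\mathcal{M}:\overrightarrow{\mathcal{S}}_{\{M_p\}}(0,\infty)\to\Lambda_{\{M_p\}}$. (c) If $\mathcal{M}:\overleftarrow{\mathcal{S}}_{\{M_p\}}(0,\infty)\to\Lambda_{\{M_p\}}$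 is surjective (resp. has a continuous linear right inverse), then so is (resp. does) $\mathcal{M}:\overleftarrow{\mathcal{S}}^0_{\{N_p\}}(\mathbb{R})\to\Lambda_{\{N_p\}}$. -/

import Mathlib

open MeasureTheory

noncomputable section

/-! ### Weight sequences -/

/-- A weight sequence: positive, `M 0 = 1`, and `M (p + 1) / M p → ∞`. -/
structure IsWeightSequence (M : ℕ → ℝ) : Prop where
  pos : ∀ p, 0 < M p
  zero : M 0 = 1
  tendsto : Filter.Tendsto (fun p => M (p + 1) / M p) Filter.atTop Filter.atTop

/-- Log-convexity (lc). -/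
def LogConvex (M : ℕ → ℝ) : Prop :=
  ∀ p, M (p + 1) ^ 2 ≤ M p * M (p + 2)

/-- Derivation-closedness (dc). -/
def DerivationClosed (M : ℕ → ℝ) : Prop :=
  ∃ C₀ H : ℝ, 1 ≤ C₀ ∧ 1 ≤ H ∧ ∀ p, M (p + 1) ≤ C₀ * H ^ (p + 1) * M p

/-- The 2-interpolating sequence: `N (2q) = M q`, `N (2q+1) = (M q * M (q+1))^(1/2)`. -/
def twoInterpolating (M : ℕ → ℝ) (p : ℕ) : ℝ :=
  if Even p then M (p / 2) else √(M (p / 2) * M (p / 2 + 1))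

theorem twoInterpolating_even (M : ℕ → ℝ) (q : ℕ) : twoInterpolating M (2 * q) = M q := by
  simp [twoInterpolating]

theorem twoInterpolating_odd (M : ℕ → ℝ) (q : ℕ) :
    twoInterpolating M (2 * q + 1) = √(M q * M (q + 1)) := by
  have h : (2 * q + 1) / 2 = q := by omega
  simp [twoInterpolating, h]

theorem IsWeightSequence.twoInterpolating {M : ℕ → ℝ} (hM : IsWeightSequence M) :
    IsWeightSequence (twoInterpolating M) := by
  have hq : ∀ q, √(M q * M (q + 1)) / M q = √(M (q + 1) / M q) := fun q => by
    have := hM.pos q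
    rw [div_eq_iff this.ne', Real.sqrt_mul this.le, Real.sqrt_div' _ this.le,
      div_mul_eq_mul_div, eq_div_iff (Real.sqrt_pos.2 this).ne']
    linear_combination √(M (q + 1)) * Real.mul_self_sqrt this.le
  have hq' : ∀ q, M (q + 1) / √(M q * M (q + 1)) = √(M (q + 1) / M q) := fun q => by
    have h0 := hM.pos q
    have h1 := hM.pos (q + 1)
    rw [Real.sqrt_mul h0.le, Real.sqrt_div' _ h0.le, div_eq_div_iff
      (mul_pos (Real.sqrt_pos.2 h0) (Real.sqrt_pos.2 h1)).ne' (Real.sqrt_pos.2 h0).ne']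
    linear_combination -√(M q) * Real.mul_self_sqrt h1.le
  refine ⟨fun p => ?_, by simpa using (twoInterpolating_even M 0).trans hM.zero, ?_⟩
  · obtain ⟨q, rfl | rfl⟩ := Nat.even_or_odd' p
    · rw [twoInterpolating_even]; exact hM.pos q
    · rw [twoInterpolating_odd]; exact Real.sqrt_pos.2 (mul_pos (hM.pos _) (hM.pos _))
  · have key : ∀ p, _root_.twoInterpolating M (p + 1) / _root_.twoInterpolating M p
        = √(M (p / 2 + 1) / M (p / 2)) := fun p => by
      obtain ⟨q, rfl | rfl⟩ := Nat.even_or_odd' p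
      · rw [twoInterpolating_even, twoInterpolating_odd, hq]; simp
      · have h : (2 * q + 1) / 2 = q := by omega
        rw [show 2 * q + 1 + 1 = 2 * (q + 1) by ring, twoInterpolating_even,
          twoInterpolating_odd, hq', h]
    simp_rw [key]
    exact Real.tendsto_sqrt_atTop.comp (hM.tendsto.comp
      (Nat.tendsto_div_const_atTop (by norm_num)))

theorem DerivationClosed.twoInterpolating {M : ℕ → ℝ} (hM : IsWeightSequence M)
    (h : DerivationClosed M) : DerivationClosed (twoInterpolating M) := by
  obtain ⟨C, H, hC, hH, h⟩ := h
  refine ⟨C, H, hC, hH, fun p => ?_⟩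
  have hCH : ∀ k, 1 ≤ C * H ^ k := fun k =>
    one_le_mul_of_one_le_of_one_le hC (one_le_pow₀ hH)
  have mono : ∀ {k l : ℕ}, k ≤ l → C * H ^ k ≤ C * H ^ l := fun hkl =>
    mul_le_mul_of_nonneg_left (pow_le_pow_right₀ hH hkl) (by linarith)
  obtain ⟨q, rfl | rfl⟩ := Nat.even_or_odd' p
  · rw [twoInterpolating_even, twoInterpolating_odd]
    have h0 := hM.pos q
    have h1 := hCH (q + 1)
    have h2 := hCH (2 * q + 1)
    apply Real.sqrt_le_iff.2
    refine ⟨by positivity, ?_⟩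
    have h3 : M (q + 1) ≤ C * H ^ (2 * q + 1) * M q :=
      (h q).trans (mul_le_mul_of_nonneg_right (mono (by omega)) h0.le)
    calc M q * M (q + 1) ≤ M q * (C * H ^ (2 * q + 1) * M q) :=
          mul_le_mul_of_nonneg_left h3 h0.le
      _ ≤ (C * H ^ (2 * q + 1)) * (M q * (C * H ^ (2 * q + 1) * M q)) :=
          le_mul_of_one_le_left (by positivity) h2
      _ = _ := by ring
  · rw [show 2 * q + 1 + 1 = 2 * (q + 1) by ring, twoInterpolating_even, twoInterpolating_odd]
    have h0 := hM.pos q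
    have h1 := hM.pos (q + 1)
    have h2 := hCH (2 * (q + 1))
    have h3 : M (q + 1) ≤ C * H ^ (2 * (q + 1)) * M q :=
      (h q).trans (mul_le_mul_of_nonneg_right (mono (by omega)) h0.le)
    have h4 : 0 ≤ C * H ^ (2 * (q + 1)) := by linarith
    apply le_of_sq_le_sq _ (by positivity)
    rw [mul_pow, Real.sq_sqrt (by positivity)]
    calc M (q + 1) ^ 2 = M (q + 1) * M (q + 1) := sq _
      _ ≤ (C * H ^ (2 * (q + 1)) * M q) * M (q + 1) := mul_le_mul_of_nonneg_right h3 h1.le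
      _ ≤ (C * H ^ (2 * (q + 1))) * ((C * H ^ (2 * (q + 1)) * M q) * M (q + 1)) :=
          le_mul_of_one_le_left (by positivity) h2
      _ = _ := by ring

/-! ### Subspaces with a topology of their own; projective and inductive limits -/

/-- A linear subspace of `V` together with a topology on it
(in general not the one induced by `V`). -/
structure TopSubspace (V : Type) [AddCommGroup V] [Module ℂ V] where
  carrier : Submodule ℂ V
  top : TopologicalSpace carrier

/-- `t` is a locally convex vector space topology. -/
def IsLocallyConvexTopology {E : Type} [AddCommGroup E] [Module ℂ E]
    (t : TopologicalSpace E) : Prop :=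
  letI := t
  IsTopologicalAddGroup E ∧ ContinuousSMul ℂ E ∧ LocallyConvexSpace ℝ E

namespace TopSubspace

variable {V : Type} [AddCommGroup V] [Module ℂ V]

/-- Projective limit: the intersection, with the coarsest topology that makes
all inclusions into the steps continuous. -/
def projLim {ι : Type} (X : ι → TopSubspace V) : TopSubspace V where
  carrier := ⨅ i, (X i).carrier
  top := ⨅ i, (X i).top.induced
    (Submodule.inclusion (iInf_le (fun j => (X j).carrier) i))

/-- Inductive limit: the sum of the steps (their union, for a directed family), with the finest
locally convex topology that makes all inclusions of the steps continuous. Topologies are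
ordered so that finer means smaller, and this infimum is itself such a topology. -/
def indLim {ι : Type} (X : ι → TopSubspace V) : TopSubspace V where
  carrier := ⨆ i, (X i).carrier
  top := sInf {t | IsLocallyConvexTopology t ∧
    ∀ i, @Continuous _ _ (X i).top t
      (Submodule.inclusion (le_iSup (fun j => (X j).carrier) i))}

/-- The subspace of those `v` in `D` for which the family `L v` is bounded. -/
def supCarrier {I : Type} (D : Submodule ℂ V) (L : D →ₗ[ℂ] (I → ℂ)) : Submodule ℂ V where
  carrier := {v | ∃ hv : v ∈ D, BddAbove (Set.range fun i => ‖L ⟨v, hv⟩ i‖)}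
  zero_mem' := ⟨D.zero_mem, 0, by
    rintro _ ⟨i, rfl⟩
    have : (⟨0, D.zero_mem⟩ : D) = 0 := rfl
    simp [this]⟩
  add_mem' := by
    rintro v w ⟨hv, B, hB⟩ ⟨hw, B', hB'⟩
    refine ⟨D.add_mem hv hw, B + B', ?_⟩
    rintro _ ⟨i, rfl⟩
    have : (⟨v + w, D.add_mem hv hw⟩ : D) = ⟨v, hv⟩ + ⟨w, hw⟩ := rfl
    simp only [this, map_add, Pi.add_apply]
    exact (norm_add_le _ _).trans (add_le_add (hB ⟨i, rfl⟩) (hB' ⟨i, rfl⟩))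
  smul_mem' := by
    rintro c v ⟨hv, B, hB⟩
    refine ⟨D.smul_mem c hv, ‖c‖ * B, ?_⟩
    rintro _ ⟨i, rfl⟩
    have : (⟨c • v, D.smul_mem c hv⟩ : D) = c • ⟨v, hv⟩ := rfl
    simp only [this, map_smul, Pi.smul_apply, norm_smul]
    exact mul_le_mul_of_nonneg_left (hB ⟨i, rfl⟩) (norm_nonneg c)

/-- The norm `sup_i |L v i|`. -/
def supNorm {I : Type} (D : Submodule ℂ V) (L : D →ₗ[ℂ] (I → ℂ)) :
    Seminorm ℂ (supCarrier D L) :=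
  Seminorm.of (fun v => ⨆ i, ‖L ⟨v.1, v.2.1⟩ i‖)
    (by
      rintro ⟨v, hv, hB⟩ ⟨w, hw, hB'⟩
      refine Real.iSup_le (fun i => ?_)
        (add_nonneg (Real.iSup_nonneg fun _ => norm_nonneg _)
          (Real.iSup_nonneg fun _ => norm_nonneg _))
      have : (⟨v + w, D.add_mem hv hw⟩ : D) = ⟨v, hv⟩ + ⟨w, hw⟩ := rfl
      simp only [Submodule.coe_add, this, map_add, Pi.add_apply]
      exact (norm_add_le _ _).trans (add_le_add (le_ciSup hB i) (le_ciSup hB' i)))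
    (by
      rintro c ⟨v, hv, hB⟩
      have : (⟨c • v, D.smul_mem c hv⟩ : D) = c • ⟨v, hv⟩ := rfl
      simp only [Submodule.coe_smul, this, map_smul, Pi.smul_apply, norm_smul]
      rw [Real.mul_iSup_of_nonneg (norm_nonneg c)])

/-- The normed space of those `v` in `D` with `sup_i |L v i| < ∞`, with this supremum as norm. -/
def supNormed {I : Type} (D : Submodule ℂ V) (L : D →ₗ[ℂ] (I → ℂ)) : TopSubspace V where
  carrier := supCarrier D L
  top := (supNorm D L).toAddGroupSeminorm.toSeminormedAddCommGroup.toPseudoMetricSpace.toUniformSpace.toTopologicalSpace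

end TopSubspace

open TopSubspace

/-! ### The sequence spaces `Λ` -/

/-- `a ↦ (h^p a_p / M_p)_p`. -/
def seqWeight (M : ℕ → ℝ) (h : ℝ) : (⊤ : Submodule ℂ (ℕ → ℂ)) →ₗ[ℂ] (ℕ → ℂ) where
  toFun a p := ((h ^ p / M p : ℝ) : ℂ) * a.1 p
  map_add' a b := by ext p; simp [mul_add]
  map_smul' c a := by ext p; simp; ring

/-- `Λ_{M_p,h}`, with norm `sup_p h^p |a_p| / M_p`. -/
def LambdaStep (M : ℕ → ℝ) (h : ℝ) : TopSubspace (ℕ → ℂ) :=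
  supNormed ⊤ (seqWeight M h)

/-- The Fréchet space `Λ_{(M_p)}`. -/
def LambdaBeurling (M : ℕ → ℝ) : TopSubspace (ℕ → ℂ) :=
  projLim fun n : ℕ => LambdaStep M (n + 1)

/-- The (LB)-space `Λ_{{M_p}}`. -/
def LambdaRoumieu (M : ℕ → ℝ) : TopSubspace (ℕ → ℂ) :=
  indLim fun h : Set.Ioi (0 : ℝ) => LambdaStep M h

/-! ### Gelfand-Shilov spaces -/

/-- `C^n(ℝ)`, complex-valued. -/
def CnSpace (n : ℕ) : Submodule ℂ (ℝ → ℂ) where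
  carrier := {φ | ContDiff ℝ n φ}
  zero_mem' := by
    show ContDiff ℝ n (fun _ : ℝ => (0 : ℂ))
    exact contDiff_const
  add_mem' := fun {φ ψ} (h : ContDiff ℝ n φ) (h' : ContDiff ℝ n ψ) => by
    show ContDiff ℝ n (φ + ψ)
    exact h.add h'
  smul_mem' := fun c φ (h : ContDiff ℝ n φ) => by
    show ContDiff ℝ n (c • φ)
    exact h.const_smul c

theorem CnSpace.contDiff {n : ℕ} {φ : ℝ → ℂ} (h : φ ∈ CnSpace n) : ContDiff ℝ n φ := h

/-- `φ ∈ C^n(ℝ)` with `supp φ ⊆ [0, ∞)`. -/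
def CnHalf (n : ℕ) : Submodule ℂ (ℝ → ℂ) where
  carrier := {φ | ContDiff ℝ n φ ∧ tsupport φ ⊆ Set.Ici 0}
  zero_mem' := ⟨contDiff_const, by simp [tsupport]⟩
  add_mem' := fun h h' => ⟨h.1.add h'.1,
    (tsupport_add _ _).trans (Set.union_subset h.2 h'.2)⟩
  smul_mem' := fun c φ h => ⟨h.1.const_smul c,
    (closure_mono (Function.support_const_smul_subset c φ)).trans h.2⟩

/-- `φ ∈ C^n(ℝ)` with `φ^(m)(0) = 0` for all `m ≤ n`. -/
def CnFlat (n : ℕ) : Submodule ℂ (ℝ → ℂ) where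
  carrier := {φ | ContDiff ℝ n φ ∧ ∀ m ≤ n, iteratedDeriv m φ 0 = 0}
  zero_mem' := ⟨contDiff_const, fun m _ => by simp⟩
  add_mem' := fun {φ ψ} h h' => ⟨h.1.add h'.1, fun m hm => by
    have hm' : ((m : ℕ∞) : WithTop ℕ∞) ≤ n := by exact_mod_cast hm
    rw [iteratedDeriv_add (h.1.of_le hm').contDiffAt (h'.1.of_le hm').contDiffAt,
      h.2 m hm, h'.2 m hm, add_zero]⟩
  smul_mem' := fun c φ h => ⟨h.1.const_smul c, fun m hm => by
    have hm' : ((m : ℕ∞) : WithTop ℕ∞) ≤ n := by exact_mod_cast hm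
    rw [iteratedDeriv_const_smul (h.1.of_le hm').contDiffAt, h.2 m hm, smul_zero]⟩

theorem CnHalf_le (n : ℕ) : CnHalf n ≤ CnSpace n := fun _ h => h.1

theorem CnFlat_le (n : ℕ) : CnFlat n ≤ CnSpace n := fun _ h => h.1

/-- `φ ↦ (h^p x^p φ^(m)(x) / M_p)` for `m ≤ n`, `p ∈ ℕ`, `x ∈ ℝ`. -/
def gsWeight (M : ℕ → ℝ) (n : ℕ) (h : ℝ) : CnSpace n →ₗ[ℂ] (Fin (n + 1) × ℕ × ℝ → ℂ) where
  toFun φ i := ((h ^ i.2.1 * i.2.2 ^ i.2.1 / M i.2.1 : ℝ) : ℂ) * iteratedDeriv i.1 φ.1 i.2.2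
  map_add' φ ψ := by
    ext i
    have hm : (((i.1 : ℕ) : ℕ∞) : WithTop ℕ∞) ≤ n := by
      exact_mod_cast Nat.lt_succ_iff.1 i.1.2
    simp only [Submodule.coe_add, Pi.add_apply]
    rw [iteratedDeriv_add ((CnSpace.contDiff φ.2).of_le hm).contDiffAt
      ((CnSpace.contDiff ψ.2).of_le hm).contDiffAt, mul_add]
  map_smul' c φ := by
    ext i
    have hm : (((i.1 : ℕ) : ℕ∞) : WithTop ℕ∞) ≤ n := by
      exact_mod_cast Nat.lt_succ_iff.1 i.1.2
    simp only [Submodule.coe_smul, Pi.smul_apply, RingHom.id_apply]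
    rw [iteratedDeriv_const_smul ((CnSpace.contDiff φ.2).of_le hm).contDiffAt, smul_eq_mul, smul_eq_mul]
    ring

/-- `S^n_{M_p,h}(0,∞)`, with norm `max_{m ≤ n} sup_p sup_x h^p |x^p φ^(m)(x)| / M_p`. -/
def HalfStep (M : ℕ → ℝ) (n : ℕ) (h : ℝ) : TopSubspace (ℝ → ℂ) :=
  supNormed (CnHalf n) (gsWeight M n h ∘ₗ Submodule.inclusion (CnHalf_le n))

/-- `S^{n,0}_{M_p,h}(ℝ)`, with norm `max_{m ≤ n} sup_p sup_x h^p |x^p φ^(m)(x)| / M_p`. -/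
def FlatStep (M : ℕ → ℝ) (n : ℕ) (h : ℝ) : TopSubspace (ℝ → ℂ) :=
  supNormed (CnFlat n) (gsWeight M n h ∘ₗ Submodule.inclusion (CnFlat_le n))

/-- The Fréchet space `S_{(M_p)}(0,∞)`. -/
def HalfBeurling (M : ℕ → ℝ) : TopSubspace (ℝ → ℂ) :=
  projLim fun n : ℕ => HalfStep M (n + 1) (n + 1)

/-- The (LF)-space `S_{{M_p}}(0,∞)`. -/
def HalfRoumieuLF (M : ℕ → ℝ) : TopSubspace (ℝ → ℂ) :=
  indLim fun h : Set.Ioi (0 : ℝ) => projLim fun n : ℕ => HalfStep M n h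

/-- The (PLB)-space `S_{{M_p}}(0,∞)`. -/
def HalfRoumieuPLB (M : ℕ → ℝ) : TopSubspace (ℝ → ℂ) :=
  projLim fun n : ℕ => indLim fun h : Set.Ioi (0 : ℝ) => HalfStep M n h

/-- The Fréchet space `S^0_{(M_p)}(ℝ)`. -/
def FlatBeurling (M : ℕ → ℝ) : TopSubspace (ℝ → ℂ) :=
  projLim fun n : ℕ => FlatStep M (n + 1) (n + 1)

/-- The (LF)-space `S^0_{{M_p}}(ℝ)`. -/
def FlatRoumieuLF (M : ℕ → ℝ) : TopSubspace (ℝ → ℂ) :=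
  indLim fun h : Set.Ioi (0 : ℝ) => projLim fun n : ℕ => FlatStep M n h

/-- The (PLB)-space `S^0_{{M_p}}(ℝ)`. -/
def FlatRoumieuPLB (M : ℕ → ℝ) : TopSubspace (ℝ → ℂ) :=
  projLim fun n : ℕ => indLim fun h : Set.Ioi (0 : ℝ) => FlatStep M n h

/-! ### The moment mapping -/

/-- The `p`-th moment. -/
def moment (φ : ℝ → ℂ) (p : ℕ) : ℂ := ∫ x : ℝ, (x : ℂ) ^ p * φ x

/-- The functions all of whose moments exist and form a sequence in `F`. -/
def momentDomain (F : Submodule ℂ (ℕ → ℂ)) : Submodule ℂ (ℝ → ℂ) where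
  carrier := {φ | (∀ p : ℕ, Integrable fun x : ℝ => (x : ℂ) ^ p * φ x) ∧ moment φ ∈ F}
  zero_mem' := by
    refine ⟨fun p => by simp, ?_⟩
    have : moment 0 = 0 := by ext p; simp [moment]
    rw [this]; exact F.zero_mem
  add_mem' := fun {φ ψ} h h' => by
    refine ⟨fun p => by
      have := (h.1 p).add (h'.1 p)
      simp only [Pi.add_apply, mul_add]
      exact this, ?_⟩
    have : moment (φ + ψ) = moment φ + moment ψ := by
      ext p
      simp only [moment, Pi.add_apply, mul_add]
      exact integral_add (h.1 p) (h'.1 p)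
    rw [this]; exact F.add_mem h.2 h'.2
  smul_mem' := fun c φ h => by
    have e : ∀ (p : ℕ) (x : ℝ), (x : ℂ) ^ p * (c • φ) x = c * ((x : ℂ) ^ p * φ x) :=
      fun p x => by simp; ring
    refine ⟨fun p => by simpa only [e] using (h.1 p).const_mul c, ?_⟩
    have : moment (c • φ) = c • moment φ := by
      ext p
      simp only [moment, e]
      exact integral_const_mul c _
    rw [this]; exact F.smul_mem c h.2

/-- The Stieltjes moment mapping `E → F`, `φ ↦ (∫ x^p φ(x) dx)_p`. -/
def momentMap (E : TopSubspace (ℝ → ℂ)) (F : TopSubspace (ℕ → ℂ))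
    (h : E.carrier ≤ momentDomain F.carrier) : E.carrier →ₗ[ℂ] F.carrier where
  toFun φ := ⟨moment φ.1, (h φ.2).2⟩
  map_add' φ ψ := by
    ext p
    simp only [moment, Submodule.coe_add, Pi.add_apply, mul_add]
    exact integral_add ((h φ.2).1 p) ((h ψ.2).1 p)
  map_smul' c φ := by
    ext p
    have e : ∀ x : ℝ, (x : ℂ) ^ p * (c • φ.1) x = c * ((x : ℂ) ^ p * φ.1 x) :=
      fun x => by simp; ring
    simp only [moment, Submodule.coe_smul, RingHom.id_apply, Pi.smul_apply, smul_eq_mul] at e ⊢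
    simp_rw [e]
    exact integral_const_mul c _

/-- `T : E → F` has a continuous linear right inverse. -/
def HasContinuousLinearRightInverse {V W : Type} [AddCommGroup V] [Module ℂ V]
    [AddCommGroup W] [Module ℂ W] {E : TopSubspace V} {F : TopSubspace W}
    (T : E.carrier →ₗ[ℂ] F.carrier) : Prop :=
  ∃ R : F.carrier →ₗ[ℂ] E.carrier, @Continuous _ _ F.top E.top R ∧ ∀ a, T (R a) = a

/-! ### The moment mapping is well defined under (dc) -/

theorem momentDomain_mono {F G : Submodule ℂ (ℕ → ℂ)} (h : F ≤ G) :
    momentDomain F ≤ momentDomain G := fun _ hφ => ⟨hφ.1, h hφ.2⟩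

theorem mem_LambdaStep {M : ℕ → ℝ} (hM : ∀ p, 0 < M p) {h : ℝ} (hh : 0 < h) {a : ℕ → ℂ} {B : ℝ}
    (hB : ∀ p, h ^ p * ‖a p‖ ≤ B * M p) : a ∈ (LambdaStep M h).carrier := by
  refine ⟨trivial, B, ?_⟩
  rintro _ ⟨p, rfl⟩
  have := hM p
  simp only [seqWeight, LinearMap.coe_mk, AddHom.coe_mk, norm_mul, Complex.norm_real,
    Real.norm_eq_abs]
  rw [abs_of_pos (by positivity), div_mul_eq_mul_div, div_le_iff₀ this]
  exact hB p

theorem LambdaStep_anti {M : ℕ → ℝ} (hM : ∀ p, 0 < M p) {h k : ℝ} (hh : 0 < h) (hk : h ≤ k) :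
    (LambdaStep M k).carrier ≤ (LambdaStep M h).carrier := by
  rintro a ⟨ha, B, hB⟩
  refine mem_LambdaStep hM hh (B := B) fun p => ?_
  have hp := hM p
  have hk0 : 0 < k := hh.trans_le hk
  have := hB ⟨p, rfl⟩
  simp only [seqWeight, LinearMap.coe_mk, AddHom.coe_mk, norm_mul, Complex.norm_real,
    Real.norm_eq_abs] at this
  rw [abs_of_pos (by positivity), div_mul_eq_mul_div, div_le_iff₀ hp] at this
  exact (mul_le_mul_of_nonneg_right (pow_le_pow_left₀ hh.le hk p) (norm_nonneg _)).trans this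

theorem momentDomain_of_step {M : ℕ → ℝ} (hM : ∀ p, 0 < M p) {C H : ℝ} (hC : 1 ≤ C) (hH : 1 ≤ H)
    (hdc : ∀ p, M (p + 1) ≤ C * H ^ (p + 1) * M p) {n : ℕ} {h : ℝ} (hh : 0 < h)
    {D : Submodule ℂ (ℝ → ℂ)} (hD : D ≤ CnSpace n) :
    (supNormed D (gsWeight M n h ∘ₗ Submodule.inclusion hD)).carrier ≤
      momentDomain (LambdaStep M (h / H ^ 2)).carrier := by
  rintro φ ⟨hφ, B, hB⟩
  have hcont : Continuous φ := (CnSpace.contDiff (hD hφ)).continuous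
  have hBp : ∀ (p : ℕ) (x : ℝ), h ^ p * (|x| ^ p * ‖φ x‖) ≤ B * M p := fun p x => by
    have := hB ⟨(0, p, x), rfl⟩
    have hp := hM p
    simp only [gsWeight, LinearMap.comp_apply, LinearMap.coe_mk, AddHom.coe_mk, norm_mul,
      Complex.norm_real, Real.norm_eq_abs, Submodule.coe_inclusion, Fin.val_zero,
      iteratedDeriv_zero, abs_div, abs_mul, abs_pow, abs_of_pos hp, abs_of_pos hh] at this
    rw [div_mul_eq_mul_div, div_le_iff₀ hp] at this
    linarith
  have hB0 : 0 ≤ B := by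
    have := (by positivity : (0 : ℝ) ≤ h ^ 0 * (|0| ^ 0 * ‖φ 0‖)).trans (hBp 0 0)
    exact nonneg_of_mul_nonneg_left this (hM 0)
  set K : ℕ → ℝ := fun p => B * M p / h ^ p + B * M (p + 2) / h ^ (p + 2) with hK
  have hle : ∀ (p : ℕ) (x : ℝ), ‖(x : ℂ) ^ p * φ x‖ ≤ K p * (1 + x ^ 2)⁻¹ := fun p x => by
    have h1 : |x| ^ p * ‖φ x‖ ≤ B * M p / h ^ p := by
      rw [le_div_iff₀ (by positivity)]; linarith [hBp p x]
    have h2 : |x| ^ (p + 2) * ‖φ x‖ ≤ B * M (p + 2) / h ^ (p + 2) := by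
      rw [le_div_iff₀ (by positivity)]; linarith [hBp (p + 2) x]
    rw [norm_mul, norm_pow, Complex.norm_real, Real.norm_eq_abs, ← div_eq_mul_inv,
      le_div_iff₀ (by positivity), hK]
    calc |x| ^ p * ‖φ x‖ * (1 + x ^ 2) = |x| ^ p * ‖φ x‖ + |x| ^ (p + 2) * ‖φ x‖ := by
          rw [← sq_abs x]; ring
      _ ≤ _ := add_le_add h1 h2
  refine ⟨fun p => ?_, ?_⟩
  · refine (integrable_inv_one_add_sq.const_mul (K p)).mono' ?_ (Filter.Eventually.of_forall (hle p))
    exact (((Complex.continuous_ofReal.pow p).mul hcont)).aestronglyMeasurable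
  · refine mem_LambdaStep hM (by positivity)
      (B := Real.pi * (B + B * (C ^ 2 * H ^ 3 / h ^ 2))) fun p => ?_
    have hint : ‖moment φ p‖ ≤ K p * Real.pi := by
      refine (norm_integral_le_of_norm_le (integrable_inv_one_add_sq.const_mul (K p))
        (Filter.Eventually.of_forall (hle p))).trans ?_
      rw [integral_const_mul, integral_univ_inv_one_add_sq]
    have hp := hM p
    have hH0 : 0 < H := by linarith
    have hC0 : 0 < C := by linarith
    have hM2 : M (p + 2) ≤ C ^ 2 * H ^ 3 * (H ^ 2) ^ p * M p := by
      calc M (p + 2) ≤ C * H ^ (p + 2) * M (p + 1) := hdc (p + 1)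
        _ ≤ C * H ^ (p + 2) * (C * H ^ (p + 1) * M p) :=
            mul_le_mul_of_nonneg_left (hdc p) (by positivity)
        _ = _ := by ring
    have hH2 : 1 ≤ (H ^ 2) ^ p := one_le_pow₀ (one_le_pow₀ hH)
    have hKp : K p ≤ (B + B * (C ^ 2 * H ^ 3 / h ^ 2)) * M p * ((H ^ 2) ^ p / h ^ p) := by
      have e1 : B * M p / h ^ p ≤ B * M p * ((H ^ 2) ^ p / h ^ p) := by
        rw [← mul_div_assoc]
        exact div_le_div_of_nonneg_right
          (le_mul_of_one_le_right (by positivity) hH2) (by positivity)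
      have e2 : B * M (p + 2) / h ^ (p + 2) ≤
          B * (C ^ 2 * H ^ 3 / h ^ 2) * M p * ((H ^ 2) ^ p / h ^ p) := by
        calc B * M (p + 2) / h ^ (p + 2)
            ≤ B * (C ^ 2 * H ^ 3 * (H ^ 2) ^ p * M p) / h ^ (p + 2) := by gcongr
          _ = _ := by rw [pow_add]; field_simp
      calc K p ≤ _ := add_le_add e1 e2
        _ = _ := by ring
    calc (h / H ^ 2) ^ p * ‖moment φ p‖
        ≤ (h / H ^ 2) ^ p * (((B + B * (C ^ 2 * H ^ 3 / h ^ 2)) * M p *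
            ((H ^ 2) ^ p / h ^ p)) * Real.pi) := by
          gcongr
          exact hint.trans (mul_le_mul_of_nonneg_right hKp Real.pi_pos.le)
      _ = _ := by rw [div_pow]; field_simp

theorem momentDomain_beurling {M : ℕ → ℝ} (hM : IsWeightSequence M) (hdc : DerivationClosed M)
    {D : ℕ → Submodule ℂ (ℝ → ℂ)} (hD : ∀ n, D n ≤ CnSpace n) :
    (projLim fun n : ℕ => supNormed (D (n + 1))
      (gsWeight M (n + 1) (n + 1) ∘ₗ Submodule.inclusion (hD (n + 1)))).carrier ≤
      momentDomain (LambdaBeurling M).carrier := by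
  obtain ⟨C, H, hC, hH, hdc⟩ := hdc
  have key : ∀ n : ℕ, ∀ φ ∈ (projLim fun n : ℕ => supNormed (D (n + 1))
      (gsWeight M (n + 1) (n + 1) ∘ₗ Submodule.inclusion (hD (n + 1)))).carrier,
      φ ∈ momentDomain (LambdaStep M (n + 1)).carrier := fun n φ hφ => by
    obtain ⟨k, hk⟩ := exists_nat_ge (((n : ℝ) + 1) * H ^ 2)
    have h1 := momentDomain_of_step hM.pos hC hH hdc (n := k + 1) (h := (k : ℝ) + 1)
      (by positivity) (hD (k + 1)) ((Submodule.mem_iInf _).1 hφ k)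
    refine momentDomain_mono (LambdaStep_anti hM.pos (by positivity) ?_) h1
    rw [le_div_iff₀ (by positivity)]
    linarith
  exact fun φ hφ => ⟨(key 0 φ hφ).1, (Submodule.mem_iInf _).2 fun n => (key n φ hφ).2⟩

theorem momentDomain_roumieu_step {M : ℕ → ℝ} (hM : IsWeightSequence M)
    (hdc : DerivationClosed M) {D : Submodule ℂ (ℝ → ℂ)} {n : ℕ} (hD : D ≤ CnSpace n)
    (h : Set.Ioi (0 : ℝ)) :
    (supNormed D (gsWeight M n h ∘ₗ Submodule.inclusion hD)).carrier ≤
      momentDomain (LambdaRoumieu M).carrier := by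
  obtain ⟨C, H, hC, hH, hdc⟩ := hdc
  have hh : (0 : ℝ) < h := h.2
  exact (momentDomain_of_step hM.pos hC hH hdc hh hD).trans (momentDomain_mono
    (le_iSup (fun h : Set.Ioi (0 : ℝ) => (LambdaStep M h).carrier)
      ⟨(h : ℝ) / H ^ 2, by simp only [Set.mem_Ioi]; positivity⟩))

theorem halfBeurling_le {M : ℕ → ℝ} (hM : IsWeightSequence M) (hdc : DerivationClosed M) :
    (HalfBeurling M).carrier ≤ momentDomain (LambdaBeurling M).carrier :=
  momentDomain_beurling hM hdc CnHalf_le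

theorem flatBeurling_le {M : ℕ → ℝ} (hM : IsWeightSequence M) (hdc : DerivationClosed M) :
    (FlatBeurling M).carrier ≤ momentDomain (LambdaBeurling M).carrier :=
  momentDomain_beurling hM hdc CnFlat_le

theorem halfRoumieuLF_le {M : ℕ → ℝ} (hM : IsWeightSequence M) (hdc : DerivationClosed M) :
    (HalfRoumieuLF M).carrier ≤ momentDomain (LambdaRoumieu M).carrier :=
  iSup_le fun h => (iInf_le _ 0).trans (momentDomain_roumieu_step hM hdc (CnHalf_le 0) h)

theorem flatRoumieuLF_le {M : ℕ → ℝ} (hM : IsWeightSequence M) (hdc : DerivationClosed M) :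
    (FlatRoumieuLF M).carrier ≤ momentDomain (LambdaRoumieu M).carrier :=
  iSup_le fun h => (iInf_le _ 0).trans (momentDomain_roumieu_step hM hdc (CnFlat_le 0) h)

theorem halfRoumieuPLB_le {M : ℕ → ℝ} (hM : IsWeightSequence M) (hdc : DerivationClosed M) :
    (HalfRoumieuPLB M).carrier ≤ momentDomain (LambdaRoumieu M).carrier :=
  (iInf_le _ 0).trans (iSup_le fun h => momentDomain_roumieu_step hM hdc (CnHalf_le 0) h)

theorem flatRoumieuPLB_le {M : ℕ → ℝ} (hM : IsWeightSequence M) (hdc : DerivationClosed M) :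
    (FlatRoumieuPLB M).carrier ≤ momentDomain (LambdaRoumieu M).carrier :=
  (iInf_le _ 0).trans (iSup_le fun h => momentDomain_roumieu_step hM hdc (CnFlat_le 0) h)

end

/-! Everything rests on the substitution $y=x^2$. If $\varphi$ is supported in $[0,\infty)$, put
$\psi_k(x)=x^k\operatorname{sgn}(x)\varphi(x^2)$. When $p+k$ is even, $x^p\psi_k$ is odd and its
integral vanishes. When $p+k=2q+1$, it is even and $\int x^p\psi_k=2\int_0^\infty
x^{2q+1}\varphi(x^2)\,dx$ is the $q$-th moment of $\varphi$. Thus $k=1$ prescribes the even moments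
and $k=0$ the odd ones: solve two half-line problems, for $(a_{2q})$ and $(a_{2q+1})$, and add the
results. Conversely, given $a$, solve the flat problem for $(a_0,0,a_1,0,\dots)$ and let $f$ be the
even part of the solution; then $f(\sqrt y)/\sqrt y$ on $(0,\infty)$ has moments $a_q$
(`moment_sqrtPullback`).

The analysis lies in the continuity of the two pullbacks, `restrictsContinuously_signSquare` and
`restrictsContinuously_sqrtPullback`. Flatness at $0$ removes the sign jump in the first and absorbs
the negative powers of $\sqrt y$ in the second, at the price of more derivatives. The decay fits
because $|x|^{2q}=|x^2|^q$ and $N_{2q}=M_q$, odd exponents being reached by geometric means. The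
first pullback also produces powers of $x$; (dc) absorbs them, with a loss in $h$ that depends on
$n$, as the Beurling and (PLB) spaces allow. For the second the loss in $h$ does not depend on $n$,
so it respects the (LF) structure.

All operations are linear and continuous, so a right inverse is transported by composing with them
(`momentMap_transfer`). -/

noncomputable section

open TopSubspace

/-! ### Continuous linear maps between subspaces with their own topology -/

namespace TopSubspace

variable {U V W : Type} [AddCommGroup U] [Module ℂ U] [AddCommGroup V] [Module ℂ V]
  [AddCommGroup W] [Module ℂ W]

/-- The linear map `T` restricts to a continuous map `E → F`. -/
def RestrictsContinuously (T : V →ₗ[ℂ] W) (E : TopSubspace V) (F : TopSubspace W) : Prop :=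
  ∃ h : ∀ v ∈ E.carrier, T v ∈ F.carrier, @Continuous _ _ E.top F.top (T.restrict h)

theorem RestrictsContinuously.comp {S : V →ₗ[ℂ] W} {T : U →ₗ[ℂ] V} {D : TopSubspace U}
    {E : TopSubspace V} {F : TopSubspace W} (hS : RestrictsContinuously S E F)
    (hT : RestrictsContinuously T D E) : RestrictsContinuously (S ∘ₗ T) D F := by
  obtain ⟨h, hc⟩ := hS
  obtain ⟨k, kc⟩ := hT
  let := D.top
  let := E.top
  let := F.top
  exact ⟨fun v hv => h _ (k v hv), hc.comp kc⟩

theorem RestrictsContinuously.zero (E : TopSubspace V) (F : TopSubspace W) :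
    RestrictsContinuously (0 : V →ₗ[ℂ] W) E F := by
  let := E.top
  let := F.top
  exact ⟨fun v _ => F.carrier.zero_mem, continuous_const (y := (0 : F.carrier))⟩

theorem RestrictsContinuously.projLim {ι κ : Type} {X : ι → TopSubspace V} {Y : κ → TopSubspace W}
    {T : V →ₗ[ℂ] W} (h : ∀ j, ∃ i, RestrictsContinuously T (X i) (Y j)) :
    RestrictsContinuously T (projLim X) (projLim Y) := by
  refine ⟨fun v hv => (Submodule.mem_iInf _).2 fun j => ?_, ?_⟩
  · obtain ⟨i, hi, -⟩ := h j
    exact hi v ((Submodule.mem_iInf _).1 hv i)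
  · refine continuous_iInf_rng.2 fun j => continuous_induced_rng.2 ?_
    obtain ⟨i, hi, hc⟩ := h j
    refine continuous_iInf_dom (i := i) ?_
    let f : (TopSubspace.projLim X).carrier → (X i).carrier :=
      Submodule.inclusion (iInf_le (fun j => (X j).carrier) i)
    exact @Continuous.comp _ _ _ ((X i).top.induced f) (X i).top (Y j).top f _ hc
      (@continuous_induced_dom _ _ f (X i).top)

theorem isLocallyConvexTopology_induced {E F : Type} [AddCommGroup E] [Module ℂ E]
    [AddCommGroup F] [Module ℂ F] {t : TopologicalSpace F} (h : IsLocallyConvexTopology t)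
    (f : E →ₗ[ℂ] F) : IsLocallyConvexTopology (t.induced f) := by
  obtain ⟨h1, h2, h3⟩ := h
  let := t
  exact ⟨topologicalAddGroup_induced f, continuousSMul_induced f,
    LocallyConvexSpace.induced (f.restrictScalars ℝ)⟩

theorem continuous_inclusion_indLim {ι : Type} (X : ι → TopSubspace V) (i : ι) :
    @Continuous _ _ (X i).top (indLim X).top
      (Submodule.inclusion (le_iSup (fun j => (X j).carrier) i)) :=
  continuous_sInf_rng.2 fun _ ht => ht.2 i

theorem isLocallyConvexTopology_indLim {ι : Type} (X : ι → TopSubspace V) :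
    IsLocallyConvexTopology (indLim X).top :=
  ⟨topologicalAddGroup_sInf fun _ ht => ht.1.1, continuousSMul_sInf fun _ ht => ht.1.2.1,
    LocallyConvexSpace.sInf fun _ ht => ht.1.2.2⟩

/-- The topology that $T$ induces on the source limit is locally convex and makes all inclusions of
steps continuous. It is therefore one of the topologies whose infimum defines the source, and the
source is finer. -/
theorem RestrictsContinuously.indLim {ι κ : Type} {X : ι → TopSubspace V} {Y : κ → TopSubspace W}
    {T : V →ₗ[ℂ] W} (h : ∀ i, ∃ j, RestrictsContinuously T (X i) (Y j)) :
    RestrictsContinuously T (indLim X) (indLim Y) := by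
  have hle : (⨆ i, (X i).carrier) ≤ (⨆ j, (Y j).carrier).comap T := iSup_le fun i v hv => by
    obtain ⟨j, hj, -⟩ := h i
    exact le_iSup (fun j => (Y j).carrier) j (hj v hv)
  refine ⟨fun v hv => hle hv, continuous_iff_le_induced.2 (sInf_le ⟨?_, fun i => ?_⟩)⟩
  · exact isLocallyConvexTopology_induced (isLocallyConvexTopology_indLim Y)
      (T.restrict (p := (TopSubspace.indLim X).carrier) (q := (TopSubspace.indLim Y).carrier)
        fun v hv => hle hv)
  · obtain ⟨j, hj, hc⟩ := h i
    refine continuous_induced_rng.2 ?_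
    let := (X i).top
    let := (Y j).top
    let := (TopSubspace.indLim Y).top
    exact (continuous_inclusion_indLim Y j).comp hc

/-- A `TopSubspace` carries a bare topology; continuity of addition is needed to add two continuous
maps in `momentMap_transfer`. -/
theorem continuousAdd_projLim {ι : Type} {X : ι → TopSubspace V}
    (h : ∀ i, @ContinuousAdd _ (X i).top _) :
    @ContinuousAdd _ (TopSubspace.projLim X).top _ := by
  refine continuousAdd_iInf fun i => ?_
  let := (X i).top
  have := h i
  exact continuousAdd_induced (Submodule.inclusion (iInf_le (fun j => (X j).carrier) i))

theorem continuousAdd_indLim {ι : Type} (X : ι → TopSubspace V) :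
    @ContinuousAdd _ (TopSubspace.indLim X).top _ := by
  let := (TopSubspace.indLim X).top
  have := (isLocallyConvexTopology_indLim X).1
  infer_instance

theorem continuousAdd_supNormed {I : Type} (D : Submodule ℂ V) (L : D →ₗ[ℂ] (I → ℂ)) :
    @ContinuousAdd _ (supNormed D L).top _ := by
  let := (supNorm D L).toAddGroupSeminorm.toSeminormedAddCommGroup
  exact (inferInstance : ContinuousAdd (supCarrier D L))

/-- Taking for $B$ the supremum itself turns the hypothesis into an operator norm bound. Allowing
every $B$ keeps suprema out of the later estimates. -/
theorem restrictsContinuously_supNormed {I J : Type} {D : Submodule ℂ V} {L : D →ₗ[ℂ] (I → ℂ)}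
    {D' : Submodule ℂ W} {L' : D' →ₗ[ℂ] (J → ℂ)} (T : V →ₗ[ℂ] W) {C : ℝ} (hC : 0 ≤ C)
    (h : ∀ v, ∀ hv : v ∈ D, ∀ B : ℝ, (∀ i, ‖L ⟨v, hv⟩ i‖ ≤ B) →
      ∃ hw : T v ∈ D', ∀ j, ‖L' ⟨T v, hw⟩ j‖ ≤ C * B) :
    RestrictsContinuously T (supNormed D L) (supNormed D' L') := by
  have hmaps : ∀ v ∈ (supNormed D L).carrier, T v ∈ (supNormed D' L').carrier := by
    rintro v ⟨hv, B, hB⟩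
    obtain ⟨hw, hj⟩ := h v hv B fun i => hB ⟨i, rfl⟩
    exact ⟨hw, C * B, by rintro _ ⟨j, rfl⟩; exact hj j⟩
  refine ⟨hmaps, ?_⟩
  let := (supNorm D L).toAddGroupSeminorm.toSeminormedAddCommGroup
  let := (supNorm D' L').toAddGroupSeminorm.toSeminormedAddCommGroup
  let f : supCarrier D L →ₗ[ℂ] supCarrier D' L' := T.restrict hmaps
  refine AddMonoidHomClass.continuous_of_bound f C ?_
  rintro ⟨v, hv, hB⟩
  obtain ⟨hw, hj⟩ := h v hv (⨆ i, ‖L ⟨v, hv⟩ i‖) fun i => le_ciSup hB i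
  exact Real.iSup_le hj (mul_nonneg hC (Real.iSup_nonneg fun _ => norm_nonneg _))

end TopSubspace

/-! ### Transport of surjectivity and of right inverses -/

/-- If $R$ is a right inverse for $E\to F$, then $T_0RU_0+T_1RU_1$ is one for $E'\to F'$. Two
summands serve the splitting into even and odd moments; in the other direction the second one is
zero. -/
theorem momentMap_transfer {E E' : TopSubspace (ℝ → ℂ)} {F F' : TopSubspace (ℕ → ℂ)}
    (hE : E.carrier ≤ momentDomain F.carrier) (hE' : E'.carrier ≤ momentDomain F'.carrier)
    (hadd : @ContinuousAdd _ E'.top _)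
    {T₀ T₁ : (ℝ → ℂ) →ₗ[ℂ] (ℝ → ℂ)} {U₀ U₁ : (ℕ → ℂ) →ₗ[ℂ] (ℕ → ℂ)}
    (hT₀ : RestrictsContinuously T₀ E E') (hT₁ : RestrictsContinuously T₁ E E')
    (hU₀ : RestrictsContinuously U₀ F' F) (hU₁ : RestrictsContinuously U₁ F' F)
    (hmom : ∀ φ₀ ∈ E.carrier, ∀ φ₁ ∈ E.carrier, ∀ a, moment φ₀ = U₀ a → moment φ₁ = U₁ a →
      moment (T₀ φ₀ + T₁ φ₁) = a) :
    (Function.Surjective (momentMap E F hE) → Function.Surjective (momentMap E' F' hE')) ∧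
    (HasContinuousLinearRightInverse (momentMap E F hE) →
      HasContinuousLinearRightInverse (momentMap E' F' hE')) := by
  obtain ⟨hT₀, cT₀⟩ := hT₀
  obtain ⟨hT₁, cT₁⟩ := hT₁
  obtain ⟨hU₀, cU₀⟩ := hU₀
  obtain ⟨hU₁, cU₁⟩ := hU₁
  constructor
  · rintro hs ⟨a, ha⟩
    obtain ⟨φ₀, h₀⟩ := hs ⟨U₀ a, hU₀ a ha⟩
    obtain ⟨φ₁, h₁⟩ := hs ⟨U₁ a, hU₁ a ha⟩
    exact ⟨⟨T₀ φ₀ + T₁ φ₁, E'.carrier.add_mem (hT₀ _ φ₀.2) (hT₁ _ φ₁.2)⟩,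
      Subtype.ext (hmom _ φ₀.2 _ φ₁.2 a (congrArg Subtype.val h₀) (congrArg Subtype.val h₁))⟩
  · rintro ⟨R, hR, hinv⟩
    refine ⟨T₀.restrict hT₀ ∘ₗ R ∘ₗ U₀.restrict hU₀ + T₁.restrict hT₁ ∘ₗ R ∘ₗ U₁.restrict hU₁,
      ?_, fun a => Subtype.ext ?_⟩
    · let := E.top
      let := F.top
      let := E'.top
      let := F'.top
      exact (cT₀.comp (hR.comp cU₀)).add (cT₁.comp (hR.comp cU₁))
    · exact hmom _ (R (U₀.restrict hU₀ a)).2 _ (R (U₁.restrict hU₁ a)).2 a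
        (congrArg Subtype.val (hinv (U₀.restrict hU₀ a)))
        (congrArg Subtype.val (hinv (U₁.restrict hU₁ a)))

/-! ### Pulling back along `x ↦ x²` -/

/-- `f ↦ (x ↦ x^k sgn(x) f(x²))`. -/
def signSquare (k : ℕ) : (ℝ → ℂ) →ₗ[ℂ] (ℝ → ℂ) where
  toFun f x := (x : ℂ) ^ k * if 0 ≤ x then f (x ^ 2) else -f (x ^ 2)
  map_add' f g := by ext x; simp only [Pi.add_apply]; split_ifs <;> ring
  map_smul' c f := by
    ext x; simp only [Pi.smul_apply, smul_eq_mul, RingHom.id_apply]; split_ifs <;> ring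

theorem signSquare_apply (k : ℕ) (f : ℝ → ℂ) (x : ℝ) :
    signSquare k f x = (x : ℂ) ^ k * if 0 ≤ x then f (x ^ 2) else -f (x ^ 2) := rfl

theorem norm_signSquare (k : ℕ) (f : ℝ → ℂ) (x : ℝ) :
    ‖signSquare k f x‖ = |x| ^ k * ‖f (x ^ 2)‖ := by
  rw [signSquare_apply, norm_mul, norm_pow, Complex.norm_real, Real.norm_eq_abs]
  split_ifs <;> simp

theorem continuous_signSquare (k : ℕ) {f : ℝ → ℂ} (hf : Continuous f) (h0 : f 0 = 0) :
    Continuous (signSquare k f) := by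
  have hc : Continuous fun x : ℝ => f (x ^ 2) := hf.comp (continuous_pow 2)
  refine (Complex.continuous_ofReal.pow k).mul
    (Continuous.if_le hc hc.neg continuous_const continuous_id ?_)
  rintro x rfl
  simp [h0]

theorem hasDerivAt_signSquare_zero {f : ℝ → ℂ} (hf : Differentiable ℝ f) (h0 : f 0 = 0) (x : ℝ) :
    HasDerivAt (signSquare 0 f) (2 * signSquare 1 (deriv f) x) x := by
  have hc : ∀ x : ℝ, HasDerivAt (fun x : ℝ => f (x ^ 2)) (2 * x * deriv f (x ^ 2)) x := fun x => by
    refine ((hf (x ^ 2)).hasDerivAt.scomp x (hasDerivAt_pow 2 x)).congr_deriv ?_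
    simp
  rcases lt_trichotomy x 0 with hx | rfl | hx
  · have h := (hc x).neg
    rw [signSquare_apply, if_neg (not_le.2 hx)]
    refine (h.congr_of_eventuallyEq ?_).congr_deriv (by ring)
    filter_upwards [gt_mem_nhds hx] with y hy
    simp [signSquare_apply, not_le.2 hy]
  -- At the origin the sign is irrelevant: the function has the same norm as $f(x^2)$, whose
  -- derivative there is $0$, and little-o only sees norms.
  · have h := hasDerivAt_iff_isLittleO.1 (hc 0)
    have e : (2 * signSquare 1 (deriv f) 0 : ℂ) = 0 := by simp [signSquare_apply]
    rw [e, hasDerivAt_iff_isLittleO, ← Asymptotics.isLittleO_norm_left]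
    refine (Asymptotics.isLittleO_norm_left.2 h).congr_left fun x => ?_
    simp only [sub_zero, Complex.ofReal_zero, mul_zero, zero_mul, smul_zero]
    rw [signSquare_apply, signSquare_apply]
    simp only [h0, pow_zero, one_mul, ne_eq, OfNat.ofNat_ne_zero, not_false_eq_true, zero_pow,
      le_refl, if_true, sub_zero]
    split_ifs <;> simp
  · have h := hc x
    rw [signSquare_apply, if_pos hx.le]
    refine (h.congr_of_eventuallyEq ?_).congr_deriv (by ring)
    filter_upwards [lt_mem_nhds hx] with y hy
    simp [signSquare_apply, le_of_lt hy]

/-- Differentiation stays inside the family `signSquare`. For $k=0$ the truncated exponent $k-1$ is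
harmless because its coefficient is zero. -/
theorem hasDerivAt_signSquare (k : ℕ) {f : ℝ → ℂ} (hf : Differentiable ℝ f) (h0 : f 0 = 0)
    (x : ℝ) : HasDerivAt (signSquare k f)
      (((k : ℂ) • signSquare (k - 1) f + (2 : ℂ) • signSquare (k + 1) (deriv f)) x) x := by
  have h1 : HasDerivAt (fun x : ℝ => (x : ℂ) ^ k) ((k : ℂ) * (x : ℂ) ^ (k - 1)) x := by
    refine ((Complex.ofRealCLM.hasDerivAt (x := x)).pow k).congr_deriv ?_
    simp
  refine ((h1.mul (hasDerivAt_signSquare_zero hf h0 x)).congr_of_eventuallyEq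
    (Filter.Eventually.of_forall fun y => ?_)).congr_deriv ?_
  · simp [signSquare_apply]
  · simp only [signSquare_apply, Pi.add_apply, Pi.smul_apply, smul_eq_mul]
    ring

theorem deriv_signSquare (k : ℕ) {f : ℝ → ℂ} (hf : Differentiable ℝ f) (h0 : f 0 = 0) :
    deriv (signSquare k f) =
      (k : ℂ) • signSquare (k - 1) f + (2 : ℂ) • signSquare (k + 1) (deriv f) :=
  funext fun x => (hasDerivAt_signSquare k hf h0 x).deriv

theorem contDiff_natCast_succ_iff {n : ℕ} {f : ℝ → ℂ} :
    ContDiff ℝ (n + 1 : ℕ) f ↔ Differentiable ℝ f ∧ ContDiff ℝ n (deriv f) := by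
  rw [Nat.cast_succ, contDiff_succ_iff_deriv]
  simp

theorem norm_iteratedDeriv_smul_add_smul_le {m : ℕ} {f g : ℝ → ℂ} (hf : ContDiff ℝ m f)
    (hg : ContDiff ℝ m g) (c d : ℂ) (x : ℝ) : ‖iteratedDeriv m (c • f + d • g) x‖ ≤
      ‖c‖ * ‖iteratedDeriv m f x‖ + ‖d‖ * ‖iteratedDeriv m g x‖ := by
  have hc : ContDiff ℝ m (c • f) := hf.const_smul c
  have hd : ContDiff ℝ m (d • g) := hg.const_smul d
  rw [iteratedDeriv_add hc.contDiffAt hd.contDiffAt, iteratedDeriv_const_smul_field,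
    iteratedDeriv_const_smul_field, ← norm_smul, ← norm_smul]
  exact norm_add_le _ _

theorem contDiff_signSquare (n : ℕ) : ∀ (k : ℕ) {f : ℝ → ℂ}, ContDiff ℝ n f →
    (∀ m ≤ n, iteratedDeriv m f 0 = 0) → ContDiff ℝ n (signSquare k f) := by
  induction n with
  | zero =>
    intro k f hf h0
    simp only [Nat.cast_zero, contDiff_zero] at hf ⊢
    exact continuous_signSquare k hf (h0 0 le_rfl)
  | succ n ih =>
    intro k f hf h0
    have hf' := contDiff_natCast_succ_iff.1 hf
    have h00 : f 0 = 0 := by simpa using h0 0 (Nat.zero_le _)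
    refine contDiff_natCast_succ_iff.2
      ⟨fun x => (hasDerivAt_signSquare k hf'.1 h00 x).differentiableAt, ?_⟩
    rw [deriv_signSquare k hf'.1 h00]
    refine ((ih (k - 1) (hf.of_le (by exact_mod_cast n.le_succ))
      fun m hm => h0 m (hm.trans n.le_succ)).const_smul (k : ℂ)).add
      ((ih (k + 1) hf'.2 fun m hm => ?_).const_smul (2 : ℂ))
    rw [← iteratedDeriv_succ']
    exact h0 _ (Nat.succ_le_succ hm)

/-- Each derivative either lowers the power of $x$ or raises it by one while differentiating $f$, so
the power never exceeds $k+m$. The bound $B$ is required only at the point $x^2$, which lets the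
decay of $f$ pass through. -/
theorem norm_iteratedDeriv_signSquare_le (m : ℕ) : ∀ k : ℕ, ∃ C : ℝ, 0 ≤ C ∧ ∀ f : ℝ → ℂ,
    ContDiff ℝ m f → (∀ j ≤ m, iteratedDeriv j f 0 = 0) → ∀ (x B : ℝ),
    (∀ j ≤ m, ‖iteratedDeriv j f (x ^ 2)‖ ≤ B) →
    ‖iteratedDeriv m (signSquare k f) x‖ ≤ C * (1 + |x|) ^ (k + m) * B := by
  induction m with
  | zero =>
    intro k
    refine ⟨1, zero_le_one, fun f _ _ x B hB => ?_⟩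
    have h := hB 0 le_rfl
    rw [iteratedDeriv_zero] at h
    rw [iteratedDeriv_zero, norm_signSquare, one_mul, add_zero]
    gcongr
    linarith
  | succ m ih =>
    intro k
    obtain ⟨C₁, hC₁, h₁⟩ := ih (k - 1)
    obtain ⟨C₂, hC₂, h₂⟩ := ih (k + 1)
    refine ⟨k * C₁ + 2 * C₂, by positivity, fun f hf h0 x B hB => ?_⟩
    have hf' := contDiff_natCast_succ_iff.1 hf
    have hfm : ContDiff ℝ m f := hf.of_le (by exact_mod_cast m.le_succ)
    have h0m : ∀ j ≤ m, iteratedDeriv j f 0 = 0 := fun j hj => h0 j (hj.trans m.le_succ)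
    have h0m' : ∀ j ≤ m, iteratedDeriv j (deriv f) 0 = 0 := fun j hj => by
      rw [← iteratedDeriv_succ']
      exact h0 _ (Nat.succ_le_succ hj)
    have hB0 : 0 ≤ B := (norm_nonneg _).trans (hB 0 (Nat.zero_le _))
    have e₁ := h₁ f hfm h0m x B fun j hj => hB j (hj.trans m.le_succ)
    have e₂ := h₂ (deriv f) hf'.2 h0m' x B fun j hj => by
      rw [← iteratedDeriv_succ']
      exact hB _ (Nat.succ_le_succ hj)
    have c₁ := contDiff_signSquare m (k - 1) hfm h0m
    have c₂ := contDiff_signSquare m (k + 1) hf'.2 h0m'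
    rw [iteratedDeriv_succ', deriv_signSquare k hf'.1 (by simpa using h0 0 (Nat.zero_le _))]
    have h1x : 1 ≤ 1 + |x| := by linarith [abs_nonneg x]
    have hpow : (1 + |x|) ^ (k - 1 + m) ≤ (1 + |x|) ^ (k + (m + 1)) :=
      pow_le_pow_right₀ h1x (by omega)
    calc _ ≤ ‖(k : ℂ)‖ * ‖iteratedDeriv m (signSquare (k - 1) f) x‖ +
          ‖(2 : ℂ)‖ * ‖iteratedDeriv m (signSquare (k + 1) (deriv f)) x‖ :=
          norm_iteratedDeriv_smul_add_smul_le c₁ c₂ _ _ _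
      _ ≤ k * (C₁ * (1 + |x|) ^ (k - 1 + m) * B) + 2 * (C₂ * (1 + |x|) ^ (k + 1 + m) * B) := by
          rw [Complex.norm_natCast, Complex.norm_ofNat]
          gcongr
      _ ≤ k * (C₁ * (1 + |x|) ^ (k + (m + 1)) * B) +
          2 * (C₂ * (1 + |x|) ^ (k + (m + 1)) * B) := by
          rw [show k + 1 + m = k + (m + 1) by ring]
          gcongr
      _ = _ := by ring

/-! ### Functions that are flat at the origin -/

/-- `f ∈ C^N`, all derivatives up to order `N` vanish at `0` and are bounded by `B`. -/
structure IsFlatBounded (N : ℕ) (B : ℝ) (f : ℝ → ℂ) : Prop where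
  contDiff : ContDiff ℝ N f
  flat : ∀ m ≤ N, iteratedDeriv m f 0 = 0
  bound : ∀ m ≤ N, ∀ x, ‖iteratedDeriv m f x‖ ≤ B

theorem IsFlatBounded.mono {N n : ℕ} {B : ℝ} {f : ℝ → ℂ} (h : IsFlatBounded N B f) (hn : n ≤ N) :
    IsFlatBounded n B f :=
  ⟨h.contDiff.of_le (by exact_mod_cast hn), fun m hm => h.flat m (hm.trans hn),
    fun m hm => h.bound m (hm.trans hn)⟩

theorem IsFlatBounded.deriv {N : ℕ} {B : ℝ} {f : ℝ → ℂ} (h : IsFlatBounded (N + 1) B f) :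
    IsFlatBounded N B (deriv f) :=
  ⟨(contDiff_natCast_succ_iff.1 h.contDiff).2,
    fun m hm => by rw [← iteratedDeriv_succ']; exact h.flat _ (Nat.succ_le_succ hm),
    fun m hm => by rw [← iteratedDeriv_succ']; exact h.bound _ (Nat.succ_le_succ hm)⟩

theorem IsFlatBounded.iteratedDeriv {B : ℝ} (j : ℕ) : ∀ {N : ℕ} {f : ℝ → ℂ},
    IsFlatBounded (N + j) B f → IsFlatBounded N B (iteratedDeriv j f) := by
  induction j with
  | zero => intro N f h; rwa [iteratedDeriv_zero]
  | succ j ih => intro N f h; rw [iteratedDeriv_succ']; exact ih (IsFlatBounded.deriv h)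

theorem IsFlatBounded.nonneg {N : ℕ} {B : ℝ} {f : ℝ → ℂ} (h : IsFlatBounded N B f) : 0 ≤ B :=
  (norm_nonneg _).trans (h.bound 0 (Nat.zero_le _) 0)

/-- Iterated mean value inequality: a bound $B|x|^l$ for $f'$ on the ball $|t|\le|x|$, together with
$f(0)=0$, gains one power of $|x|$. -/
theorem IsFlatBounded.norm_le {B : ℝ} (l : ℕ) : ∀ {f : ℝ → ℂ}, IsFlatBounded l B f →
    ∀ x, ‖f x‖ ≤ B * |x| ^ l := by
  induction l with
  | zero => intro f h x; simpa using h.bound 0 le_rfl x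
  | succ l ih =>
    intro f h x
    have hB := h.nonneg
    have h0 : f 0 = 0 := by simpa using h.flat 0 (Nat.zero_le _)
    have := (convex_closedBall (0 : ℝ) |x|).norm_image_sub_le_of_norm_deriv_le (f := f)
      (C := B * |x| ^ l) (x := 0) (y := x)
      (fun t _ => (contDiff_natCast_succ_iff.1 h.contDiff).1 t)
      (fun t ht => (ih h.deriv t).trans (by
        have : |t| ≤ |x| := by simpa using ht
        gcongr)) (by simp) (by simp)
    rw [h0, sub_zero, sub_zero, Real.norm_eq_abs] at this
    rwa [pow_succ, ← mul_assoc]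

/-! ### Pulling back along `y ↦ √y` -/

/-- `f ↦ (y ↦ f(√y) / √y^k)` on `(0, ∞)`, extended by zero. -/
def sqrtPullback (k : ℕ) : (ℝ → ℂ) →ₗ[ℂ] (ℝ → ℂ) where
  toFun f y := if 0 < y then f √y / (√y : ℂ) ^ k else 0
  map_add' f g := by ext x; simp only [Pi.add_apply]; split_ifs <;> ring
  map_smul' c f := by
    ext x; simp only [Pi.smul_apply, smul_eq_mul, RingHom.id_apply]; split_ifs <;> ring

theorem sqrtPullback_of_pos (k : ℕ) (f : ℝ → ℂ) {y : ℝ} (hy : 0 < y) :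
    sqrtPullback k f y = f √y / (√y : ℂ) ^ k := if_pos hy

theorem sqrtPullback_of_nonpos (k : ℕ) (f : ℝ → ℂ) {y : ℝ} (hy : y ≤ 0) :
    sqrtPullback k f y = 0 := if_neg (not_lt.2 hy)

theorem norm_sqrtPullback_of_pos (k : ℕ) (f : ℝ → ℂ) {y : ℝ} (hy : 0 < y) :
    ‖sqrtPullback k f y‖ = ‖f √y‖ / √y ^ k := by
  rw [sqrtPullback_of_pos k f hy, norm_div, norm_pow, Complex.norm_real, Real.norm_eq_abs,
    abs_of_nonneg (Real.sqrt_nonneg y)]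

theorem norm_sqrtPullback_le (k l : ℕ) {f : ℝ → ℂ} {B : ℝ} (h : IsFlatBounded (k + l) B f)
    (y : ℝ) : ‖sqrtPullback k f y‖ ≤ B * √y ^ l := by
  have hB := h.nonneg
  rcases le_or_gt y 0 with hy | hy
  · rw [sqrtPullback_of_nonpos k f hy, norm_zero]
    positivity
  · have hs := Real.sqrt_pos.2 hy
    rw [norm_sqrtPullback_of_pos k f hy, div_le_iff₀ (by positivity)]
    refine (h.norm_le _ _).trans_eq ?_
    rw [abs_of_pos hs]
    ring

/-- The family `sqrtPullback` is closed under differentiation, but each derivative raises the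
exponent of $1/\sqrt y$ by up to two. -/
theorem hasDerivAt_sqrtPullback (k : ℕ) {f : ℝ → ℂ} {B : ℝ} (h : IsFlatBounded (k + 4) B f)
    (y : ℝ) : HasDerivAt (sqrtPullback k f)
      (((-k / 2 : ℂ) • sqrtPullback (k + 2) f + (1 / 2 : ℂ) • sqrtPullback (k + 1) (deriv f)) y)
      y := by
  rcases lt_trichotomy y 0 with hy | rfl | hy
  · refine ((hasDerivAt_const y (0 : ℂ)).congr_of_eventuallyEq ?_).congr_deriv ?_
    · filter_upwards [gt_mem_nhds hy] with z hz
      exact sqrtPullback_of_nonpos k f (le_of_lt hz)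
    · simp [sqrtPullback_of_nonpos _ _ hy.le]
  -- Four orders of flatness beyond $k$ leave $\sqrt y^{\,4}=y^2$, and a quadratic bound forces
  -- derivative zero at the origin.
  · have hO : sqrtPullback k f =O[nhds 0] fun y : ℝ => ‖y - 0‖ ^ 2 := by
      refine Asymptotics.IsBigO.of_bound B (Filter.Eventually.of_forall fun y => ?_)
      refine (norm_sqrtPullback_le k 4 h y).trans ?_
      have hB := h.nonneg
      rcases le_or_gt y 0 with hy | hy
      · rw [Real.sqrt_eq_zero_of_nonpos hy]
        simp only [ne_eq, OfNat.ofNat_ne_zero, not_false_eq_true, zero_pow, mul_zero]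
        positivity
      · rw [show √y ^ 4 = (√y ^ 2) ^ 2 by ring, Real.sq_sqrt hy.le]
        simp
    refine (hO.hasFDerivAt one_lt_two).hasDerivAt.congr_deriv ?_
    simp [sqrtPullback_of_nonpos]
  · have hs := Real.sqrt_pos.2 hy
    have hs' : (√y : ℂ) ≠ 0 := by exact_mod_cast hs.ne'
    have hsq := Real.hasDerivAt_sqrt hy.ne'
    have hd : Differentiable ℝ f := (contDiff_natCast_succ_iff (n := k + 3).1 h.contDiff).1
    have h1 : HasDerivAt (fun y => f √y) ((1 / (2 * √y)) • deriv f √y) y :=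
      (hd √y).hasDerivAt.scomp y hsq
    have h2 : HasDerivAt (fun y : ℝ => ((√y : ℂ)) ^ k)
        ((k : ℂ) * (√y : ℂ) ^ (k - 1) * ((1 / (2 * √y) : ℝ) : ℂ)) y := hsq.ofReal_comp.pow k
    refine ((h1.div h2 (pow_ne_zero k hs')).congr_of_eventuallyEq ?_).congr_deriv ?_
    · filter_upwards [lt_mem_nhds hy] with z hz
      exact sqrtPullback_of_pos k f hz
    · simp only [Pi.add_apply, Pi.smul_apply, smul_eq_mul, sqrtPullback_of_pos _ _ hy,
        Complex.real_smul]
      push_cast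
      rcases k with _ | k
      · simp
        field_simp
      · rw [Nat.add_sub_cancel]
        field_simp
        ring

theorem deriv_sqrtPullback (k : ℕ) {f : ℝ → ℂ} {B : ℝ} (h : IsFlatBounded (k + 4) B f) :
    deriv (sqrtPullback k f) =
      (-k / 2 : ℂ) • sqrtPullback (k + 2) f + (1 / 2 : ℂ) • sqrtPullback (k + 1) (deriv f) :=
  funext fun y => (hasDerivAt_sqrtPullback k h y).deriv

/-- Flatness $2n$ pays for the growth of the exponent over $n$ derivatives; the extra $4$ is what
the differentiation rule itself needs. -/
theorem contDiff_sqrtPullback {B : ℝ} (n : ℕ) : ∀ (k : ℕ) {f : ℝ → ℂ},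
    IsFlatBounded (k + 2 * n + 4) B f → ContDiff ℝ n (sqrtPullback k f) := by
  induction n with
  | zero =>
    intro k f h
    rw [Nat.cast_zero, contDiff_zero]
    exact continuous_iff_continuousAt.2 fun y => (hasDerivAt_sqrtPullback k h y).continuousAt
  | succ n ih =>
    intro k f h
    have h4 : IsFlatBounded (k + 4) B f := h.mono (by omega)
    refine contDiff_natCast_succ_iff.2
      ⟨fun y => (hasDerivAt_sqrtPullback k h4 y).differentiableAt, ?_⟩
    rw [deriv_sqrtPullback k h4]
    refine ((ih (k + 2) (h.mono (by omega))).const_smul (-k / 2 : ℂ)).add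
      ((ih (k + 1) (IsFlatBounded.deriv (h.mono (by omega)))).const_smul (1 / 2 : ℂ))

/-- The derivative is a combination of terms $f^{(j)}(\sqrt y)/\sqrt y^{\,i}$ with $j\le m$, $i\le
k+2m$. The pointwise bound $D$ is left free so that it can be chosen differently near the origin and
far from it. -/
theorem norm_iteratedDeriv_sqrtPullback_le (m : ℕ) : ∀ k : ℕ, ∃ C : ℝ, 0 ≤ C ∧
    ∀ (f : ℝ → ℂ) (B : ℝ), IsFlatBounded (k + 2 * m + 4) B f → ∀ (y D : ℝ),
    (∀ j ≤ m, ∀ i ≤ k + 2 * m, ‖sqrtPullback i (iteratedDeriv j f) y‖ ≤ D) →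
    ‖iteratedDeriv m (sqrtPullback k f) y‖ ≤ C * D := by
  induction m with
  | zero =>
    intro k
    refine ⟨1, zero_le_one, fun f B _ y D hD => ?_⟩
    simpa using hD 0 le_rfl k le_rfl
  | succ m ih =>
    intro k
    obtain ⟨C₁, hC₁, h₁⟩ := ih (k + 2)
    obtain ⟨C₂, hC₂, h₂⟩ := ih (k + 1)
    refine ⟨k / 2 * C₁ + 1 / 2 * C₂, by positivity, fun f B h y D hD => ?_⟩
    have hf₁ : IsFlatBounded (k + 2 + 2 * m + 4) B f := h.mono (by omega)
    have hf₂ : IsFlatBounded (k + 1 + 2 * m + 4) B (deriv f) :=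
      IsFlatBounded.deriv (h.mono (by omega))
    have e₁ := h₁ f B hf₁ y D fun j hj i hi => hD j (by omega) i (by omega)
    have e₂ := h₂ (deriv f) B hf₂ y D fun j hj i hi => by
      rw [← iteratedDeriv_succ']
      exact hD _ (by omega) i (by omega)
    have c₁ := contDiff_sqrtPullback m (k + 2) hf₁
    have c₂ := contDiff_sqrtPullback m (k + 1) hf₂
    rw [iteratedDeriv_succ', deriv_sqrtPullback k (h.mono (by omega))]
    calc _ ≤ ‖(-k / 2 : ℂ)‖ * ‖iteratedDeriv m (sqrtPullback (k + 2) f) y‖ +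
          ‖(1 / 2 : ℂ)‖ * ‖iteratedDeriv m (sqrtPullback (k + 1) (deriv f)) y‖ :=
          norm_iteratedDeriv_smul_add_smul_le c₁ c₂ _ _ _
      _ ≤ k / 2 * (C₁ * D) + 1 / 2 * (C₂ * D) := by
          gcongr <;> simp
      _ = _ := by ring

/-! ### Estimates between the steps -/

/-- `h^p |x^p φ^(m)(x)| ≤ B M_p` for `m ≤ n`, `p ∈ ℕ`, `x ∈ ℝ`. -/
def GSBound (M : ℕ → ℝ) (n : ℕ) (h B : ℝ) (φ : ℝ → ℂ) : Prop :=
  ∀ m ≤ n, ∀ (p : ℕ) (x : ℝ), h ^ p * (|x| ^ p * ‖iteratedDeriv m φ x‖) ≤ B * M p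

theorem norm_gsWeight_le_iff {M : ℕ → ℝ} (hM : ∀ p, 0 < M p) {n : ℕ} {h : ℝ} (hh : 0 < h)
    (φ : CnSpace n) (i : Fin (n + 1) × ℕ × ℝ) (B : ℝ) : ‖gsWeight M n h φ i‖ ≤ B ↔
      h ^ i.2.1 * (|i.2.2| ^ i.2.1 * ‖iteratedDeriv i.1 φ.1 i.2.2‖) ≤ B * M i.2.1 := by
  have hp := hM i.2.1
  simp only [gsWeight, LinearMap.coe_mk, AddHom.coe_mk, norm_mul, Complex.norm_real,
    Real.norm_eq_abs, abs_div, abs_mul, abs_pow, abs_of_pos hp, abs_of_pos hh]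
  rw [div_mul_eq_mul_div, div_le_iff₀ hp, mul_assoc]

theorem restrictsContinuously_gsStep {M N : ℕ → ℝ} (hM : ∀ p, 0 < M p) (hN : ∀ p, 0 < N p)
    {n n' : ℕ} {h h' : ℝ} (hh : 0 < h) (hh' : 0 < h') {D D' : Submodule ℂ (ℝ → ℂ)}
    (hD : D ≤ CnSpace n) (hD' : D' ≤ CnSpace n') (T : (ℝ → ℂ) →ₗ[ℂ] (ℝ → ℂ)) {C : ℝ}
    (hC : 0 ≤ C)
    (hT : ∀ φ ∈ D, ∀ B, GSBound M n h B φ → T φ ∈ D' ∧ GSBound N n' h' (C * B) (T φ)) :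
    RestrictsContinuously T (supNormed D (gsWeight M n h ∘ₗ Submodule.inclusion hD))
      (supNormed D' (gsWeight N n' h' ∘ₗ Submodule.inclusion hD')) := by
  refine restrictsContinuously_supNormed T hC fun φ hφ B hB => ?_
  obtain ⟨h1, h2⟩ := hT φ hφ B fun m hm p x =>
    (norm_gsWeight_le_iff hM hh _ (⟨m, Nat.lt_succ_of_le hm⟩, p, x) B).1 (hB _)
  exact ⟨h1, fun j => (norm_gsWeight_le_iff hN hh' _ j _).2
    (h2 j.1 (Nat.le_of_lt_succ j.1.2) j.2.1 j.2.2)⟩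

theorem GSBound.nonneg {M : ℕ → ℝ} (hM : IsWeightSequence M) {n : ℕ} {h B : ℝ} {φ : ℝ → ℂ}
    (hφ : GSBound M n h B φ) : 0 ≤ B := by
  have := hφ 0 (Nat.zero_le _) 0 0
  simp only [pow_zero, one_mul, hM.zero, mul_one] at this
  exact (norm_nonneg _).trans this

theorem GSBound.norm_le {M : ℕ → ℝ} (hM : IsWeightSequence M) {n : ℕ} {h B : ℝ} {φ : ℝ → ℂ}
    (hφ : GSBound M n h B φ) {m : ℕ} (hm : m ≤ n) (x : ℝ) : ‖iteratedDeriv m φ x‖ ≤ B := by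
  simpa [hM.zero] using hφ m hm 0 x

theorem iteratedDeriv_eq_zero_of_mem_CnHalf {n : ℕ} {φ : ℝ → ℂ} (hφ : φ ∈ CnHalf n) {m : ℕ}
    (hm : m ≤ n) {x : ℝ} (hx : x ≤ 0) : iteratedDeriv m φ x = 0 := by
  have hneg : Set.EqOn (iteratedDeriv m φ) (fun _ => 0) (Set.Iio 0) := fun y hy => by
    have : φ =ᶠ[nhds y] fun _ => 0 := by
      filter_upwards [gt_mem_nhds hy] with z hz
      by_contra hne
      exact absurd (hφ.2 (subset_tsupport φ hne)) (not_le.2 hz)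
    rw [this.iteratedDeriv_eq]
    simp
  have hcont : Continuous (iteratedDeriv m φ) :=
    ContDiff.continuous_iteratedDeriv m hφ.1 (by exact_mod_cast hm)
  exact hneg.closure hcont continuous_const (by rwa [closure_Iio])

/-! ### Growth of the weights and elementary inequalities -/

/-- Once $M_{q+1}/M_q\ge h$, the quotient $h^q/M_q$ no longer increases, so its finitely many
initial values control it. -/
theorem IsWeightSequence.exists_pow_le {M : ℕ → ℝ} (hM : IsWeightSequence M) {h : ℝ}
    (hh : 0 < h) : ∃ K : ℝ, 0 ≤ K ∧ ∀ q, h ^ q ≤ K * M q := by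
  obtain ⟨q₀, hq₀⟩ := Filter.eventually_atTop.1 (hM.tendsto.eventually_ge_atTop h)
  have hnn : ∀ i, 0 ≤ h ^ i / M i := fun i => div_nonneg (pow_nonneg hh.le i) (hM.pos i).le
  refine ⟨∑ i ∈ Finset.range (q₀ + 1), h ^ i / M i, Finset.sum_nonneg fun i _ => hnn i, ?_⟩
  have small : ∀ q ≤ q₀, h ^ q ≤ (∑ i ∈ Finset.range (q₀ + 1), h ^ i / M i) * M q :=
    fun q hq => (div_le_iff₀ (hM.pos q)).1 (Finset.single_le_sum (f := fun i => h ^ i / M i)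
      (fun i _ => hnn i) (Finset.mem_range.2 (Nat.lt_succ_of_le hq)))
  intro q
  induction q with
  | zero => exact small 0 (Nat.zero_le _)
  | succ q ih =>
    rcases lt_or_ge q q₀ with hq | hq
    · exact small _ hq
    · have h1 := (le_div_iff₀ (hM.pos q)).1 (hq₀ q hq)
      calc h ^ (q + 1) = h * h ^ q := pow_succ' h q
        _ ≤ h * ((∑ i ∈ Finset.range (q₀ + 1), h ^ i / M i) * M q) := by gcongr
        _ = (∑ i ∈ Finset.range (q₀ + 1), h ^ i / M i) * (h * M q) := by ring
        _ ≤ _ := mul_le_mul_of_nonneg_left h1 (Finset.sum_nonneg fun i _ => hnn i)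

/-- Iterated (dc): multiplying by $x^r$ costs only a factor $H^r$ in the parameter $h$. -/
theorem exists_shift_le {N : ℕ → ℝ} {C H : ℝ} (hC : 1 ≤ C) (hH : 1 ≤ H)
    (hdc : ∀ p, N (p + 1) ≤ C * H ^ (p + 1) * N p) (r : ℕ) :
    ∃ K : ℝ, 0 ≤ K ∧ ∀ p, N (p + r) ≤ K * (H ^ r) ^ p * N p := by
  induction r with
  | zero => exact ⟨1, zero_le_one, fun p => by simp⟩
  | succ r ih =>
    obtain ⟨K, hK, h⟩ := ih
    refine ⟨C * H ^ (r + 1) * K, by positivity, fun p => ?_⟩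
    calc N (p + (r + 1)) ≤ C * H ^ (p + r + 1) * N (p + r) := hdc (p + r)
      _ ≤ C * H ^ (p + r + 1) * (K * (H ^ r) ^ p * N p) := by
          gcongr
          exact h p
      _ = _ := by ring

/-- Replaces all derivatives of order at most $n$ at a point by the largest one, to which a
`GSBound` applies for every power simultaneously. -/
theorem exists_le_max {α : Type} (f : ℕ → α → ℝ) (n : ℕ) (x : α) :
    ∃ j₀ ≤ n, ∀ j ≤ n, f j x ≤ f j₀ x := by
  obtain ⟨j₀, h₀, h⟩ := Finset.exists_max_image (Finset.range (n + 1)) (fun j => f j x)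
    ⟨0, by simp⟩
  exact ⟨j₀, Nat.le_of_lt_succ (Finset.mem_range.1 h₀), fun j hj =>
    h j (Finset.mem_range.2 (Nat.lt_succ_of_le hj))⟩

theorem exists_uniform_bound {P : ℕ → ℝ → Prop} (n : ℕ)
    (hP : ∀ m, ∃ C : ℝ, 0 ≤ C ∧ P m C) (hmono : ∀ m C C', C ≤ C' → P m C → P m C') :
    ∃ C : ℝ, 0 ≤ C ∧ ∀ m ≤ n, P m C := by
  choose C hC h using hP
  exact ⟨∑ i ∈ Finset.range (n + 1), C i, Finset.sum_nonneg fun i _ => hC i, fun m hm =>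
    hmono m _ _ (Finset.single_le_sum (fun i _ => hC i)
      (Finset.mem_range.2 (Nat.lt_succ_of_le hm))) (h m)⟩

/-- For odd $s$, take the geometric mean of the bounds at $2q$ and $2q+2$; this is exactly how
$N_{2q+1}$ is defined. -/
theorem interpolate_le {M : ℕ → ℝ} (hM : IsWeightSequence M) {t A B : ℝ} (ht : 0 ≤ t)
    (hA : 0 ≤ A) (hB : 0 ≤ B) (h : ∀ q, t ^ (2 * q) * A ≤ B * M q) (s : ℕ) :
    t ^ s * A ≤ B * twoInterpolating M s := by
  obtain ⟨q, rfl | rfl⟩ := Nat.even_or_odd' s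
  · rw [twoInterpolating_even]
    exact h q
  · rw [twoInterpolating_odd]
    have h0 := hM.pos q
    have h1 := hM.pos (q + 1)
    refine le_of_sq_le_sq ?_ (by positivity)
    rw [mul_pow B, Real.sq_sqrt (by positivity)]
    calc (t ^ (2 * q + 1) * A) ^ 2 = (t ^ (2 * q) * A) * (t ^ (2 * (q + 1)) * A) := by ring
      _ ≤ (B * M q) * (B * M (q + 1)) := mul_le_mul (h q) (h (q + 1)) (by positivity)
          (by positivity)
      _ = _ := by ring

theorem one_add_pow_le (t : ℝ) (ht : 0 ≤ t) (r : ℕ) : (1 + t) ^ r ≤ 2 ^ r * (1 + t ^ r) := by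
  have h1 : (1 + t) ^ r ≤ (2 * max 1 t) ^ r :=
    pow_le_pow_left₀ (by linarith) (by linarith [le_max_left 1 t, le_max_right 1 t]) r
  refine h1.trans ?_
  rw [mul_pow]
  gcongr
  rcases le_total 1 t with h | h
  · rw [max_eq_right h]; linarith
  · rw [max_eq_left h, one_pow]; linarith [pow_nonneg ht r]

/-- Evaluating the decay of $\varphi$ at $x^2$ controls $|x|^{2q}$ by $M_q$, hence every $|x|^s$ by
$N_s$. The factor $(1+|x|)^{k+n}$ from differentiation is then absorbed by (dc). -/
theorem restrictsContinuously_signSquare {M : ℕ → ℝ} (hM : IsWeightSequence M) {C H : ℝ}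
    (hC : 1 ≤ C) (hH : 1 ≤ H)
    (hdc : ∀ p, twoInterpolating M (p + 1) ≤ C * H ^ (p + 1) * twoInterpolating M p)
    (k : ℕ) {n n' : ℕ} (hn : n ≤ n') {h h' : ℝ} (hh : 0 < h) (hh' : (h * H ^ (k + n)) ^ 2 ≤ h') :
    RestrictsContinuously (signSquare k) (HalfStep M n' h')
      (FlatStep (twoInterpolating M) n h) := by
  have hN := hM.twoInterpolating
  obtain ⟨K, hK, hshift⟩ := exists_shift_le hC hH hdc (k + n)
  obtain ⟨C', hC', hder⟩ := exists_uniform_bound n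
    (fun m => norm_iteratedDeriv_signSquare_le m k) (by
      intro m C C' hCC hP f hf h0 x B hB
      have : 0 ≤ B := (norm_nonneg _).trans (hB 0 (Nat.zero_le _))
      exact (hP f hf h0 x B hB).trans (by gcongr))
  -- The surplus of $l$ over $h$ is reserved for the factor $(H^{k+n})^p$ that appears when the
  -- index is shifted by $k+n$.
  set l := h * H ^ (k + n) with hl
  have hl0 : 0 < l := by positivity
  have hhl : h ≤ l := le_mul_of_one_le_right hh.le (one_le_pow₀ hH)
  have hh'0 : 0 < h' := lt_of_lt_of_le (by positivity) hh'
  refine restrictsContinuously_gsStep hM.pos hN.pos hh'0 hh (CnHalf_le n') (CnFlat_le n) _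
    (C := C' * 2 ^ (k + n) * (1 + K / l ^ (k + n))) (by positivity) fun φ hφ B hB => ?_
  have hφn : ContDiff ℝ n φ := hφ.1.of_le (by exact_mod_cast hn)
  have hφ0 : ∀ m ≤ n, iteratedDeriv m φ 0 = 0 := fun m hm =>
    iteratedDeriv_eq_zero_of_mem_CnHalf hφ (hm.trans hn) le_rfl
  have hB0 := hB.nonneg hM
  refine ⟨⟨contDiff_signSquare n k hφn hφ0, fun m hm => ?_⟩, fun m hm p x => ?_⟩
  -- Flatness of the image is the derivative estimate at $x=0$ with bound $0$.
  · have := hder m hm φ (hφn.of_le (by exact_mod_cast hm))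
      (fun j hj => hφ0 j (hj.trans hm)) 0 0 (fun j hj => by
        simp [hφ0 j (hj.trans hm)])
    simpa using this
  · obtain ⟨j₀, hj₀, hmax⟩ := exists_le_max (fun j x => ‖iteratedDeriv j φ (x ^ 2)‖) n x
    set A := ‖iteratedDeriv j₀ φ (x ^ 2)‖ with hA
    have hA0 : 0 ≤ A := norm_nonneg _
    have hd := hder m hm φ (hφn.of_le (by exact_mod_cast hm))
      (fun j hj => hφ0 j (hj.trans hm)) x A (fun j hj => hmax j (hj.trans hm))
    have hint : ∀ s, (l * |x|) ^ s * A ≤ B * twoInterpolating M s := by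
      refine interpolate_le hM (by positivity) hA0 hB0 fun q => ?_
      refine le_trans ?_ (hB j₀ (hj₀.trans hn) q (x ^ 2))
      rw [← hA, pow_mul, mul_pow, mul_pow, sq_abs, abs_of_nonneg (sq_nonneg x), mul_assoc]
      gcongr
    have e₁ : h ^ p * (|x| ^ p * A) ≤ B * twoInterpolating M p := by
      refine le_trans ?_ (hint p)
      rw [mul_pow, mul_assoc]
      gcongr
    have e₂ : h ^ p * (|x| ^ (p + (k + n)) * A) ≤
        B * (K / l ^ (k + n)) * twoInterpolating M p := by
      have h1 := (hint (p + (k + n))).trans (mul_le_mul_of_nonneg_left (hshift p) hB0)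
      have h2 : (l * |x|) ^ (p + (k + n)) * A =
          ((H ^ (k + n)) ^ p) * (l ^ (k + n) * (h ^ p * (|x| ^ (p + (k + n)) * A))) := by
        rw [mul_pow, pow_add l, hl, mul_pow h _ p]
        ring
      have h3 : B * (K * (H ^ (k + n)) ^ p * twoInterpolating M p) =
          ((H ^ (k + n)) ^ p) * (B * K * twoInterpolating M p) := by ring
      rw [h2, h3] at h1
      have h4 := le_of_mul_le_mul_left h1 (by positivity)
      rw [mul_comm, ← le_div_iff₀ (by positivity)] at h4
      refine h4.trans_eq ?_
      ring
    have hpow : (1 + |x|) ^ (k + m) ≤ 2 ^ (k + n) * (1 + |x| ^ (k + n)) :=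
      (pow_le_pow_right₀ (by linarith [abs_nonneg x]) (by omega)).trans
        (one_add_pow_le _ (abs_nonneg x) _)
    calc h ^ p * (|x| ^ p * ‖iteratedDeriv m (signSquare k φ) x‖)
        ≤ h ^ p * (|x| ^ p * (C' * (2 ^ (k + n) * (1 + |x| ^ (k + n))) * A)) := by
          gcongr
          exact hd.trans (by gcongr)
      _ = C' * 2 ^ (k + n) * (h ^ p * (|x| ^ p * A) + h ^ p * (|x| ^ (p + (k + n)) * A)) := by
          rw [pow_add |x|]
          ring
      _ ≤ C' * 2 ^ (k + n) * (B * twoInterpolating M p +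
          B * (K / l ^ (k + n)) * twoInterpolating M p) := by gcongr
      _ = _ := by ring

theorem GSBound.isFlatBounded {M : ℕ → ℝ} (hM : IsWeightSequence M) {n : ℕ} {h B : ℝ}
    {φ : ℝ → ℂ} (hφ : GSBound M n h B φ) (h0 : φ ∈ CnFlat n) : IsFlatBounded n B φ :=
  ⟨h0.1, h0.2, fun _ hm => hφ.norm_le hM hm⟩

/-- For $y\ge1$ the divisions by $\sqrt y$ only help, and the bound at $\sqrt y$ with exponent $2q$
is the desired one since $N_{2q}=M_q$. For $0<y<1$ flatness bounds the quotients and $h'^q\le KM_q$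
does the rest. The order $3n+5$ covers both the $2n+5$ orders needed for smoothness and the
$i+j\le3n+1$ used near the origin. -/
theorem restrictsContinuously_sqrtPullback {M : ℕ → ℝ} (hM : IsWeightSequence M)
    {n n' : ℕ} (hn : 3 * n + 5 ≤ n') {h h' : ℝ} (hh : 0 < h) (hh' : 0 < h') (hle : h' ≤ h ^ 2) :
    RestrictsContinuously (sqrtPullback 1) (FlatStep (twoInterpolating M) n' h)
      (HalfStep M n h') := by
  have hN := hM.twoInterpolating
  obtain ⟨K, hK, hgrow⟩ := hM.exists_pow_le hh'
  obtain ⟨C, hC, hder⟩ := exists_uniform_bound n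
    (fun m => norm_iteratedDeriv_sqrtPullback_le m 1) (by
      intro m C C' hCC hP f B hf y D hD
      have : 0 ≤ D := (norm_nonneg _).trans (hD 0 (Nat.zero_le _) 0 (Nat.zero_le _))
      exact (hP f B hf y D hD).trans (by gcongr))
  refine restrictsContinuously_gsStep hN.pos hM.pos hh hh' (CnFlat_le n') (CnHalf_le n) _
    (C := C * (1 + K)) (by positivity) fun φ hφ B hB => ?_
  have hB0 := hB.nonneg hN
  have hflat := hB.isFlatBounded hN hφ
  refine ⟨⟨contDiff_sqrtPullback n 1 (hflat.mono (by omega)), ?_⟩, fun m hm q y => ?_⟩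
  · refine closure_minimal (fun y hy => ?_) isClosed_Ici
    by_contra hneg
    exact hy (sqrtPullback_of_nonpos 1 φ (le_of_lt (not_le.1 hneg)))
  have hq := hM.pos q
  have hd := fun D => hder m hm φ B (hflat.mono (by omega)) y D
  suffices ∃ D, (∀ j ≤ m, ∀ i ≤ 1 + 2 * m, ‖sqrtPullback i (iteratedDeriv j φ) y‖ ≤ D) ∧
      h' ^ q * (|y| ^ q * D) ≤ (1 + K) * B * M q by
    obtain ⟨D, hD, hDq⟩ := this
    calc h' ^ q * (|y| ^ q * ‖iteratedDeriv m (sqrtPullback 1 φ) y‖)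
        ≤ h' ^ q * (|y| ^ q * (C * D)) := by
          gcongr
          exact hd D hD
      _ = C * (h' ^ q * (|y| ^ q * D)) := by ring
      _ ≤ C * ((1 + K) * B * M q) := by gcongr
      _ = _ := by ring
  rcases le_or_gt y 0 with hy | hy
  · refine ⟨0, fun j _ i _ => by rw [sqrtPullback_of_nonpos _ _ hy, norm_zero], ?_⟩
    simp only [mul_zero]
    positivity
  have hs := Real.sqrt_pos.2 hy
  rcases le_or_gt 1 y with h1 | h1
  · obtain ⟨j₀, hj₀, hmax⟩ := exists_le_max (fun j x => ‖iteratedDeriv j φ x‖) n √y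
    refine ⟨‖iteratedDeriv j₀ φ √y‖, fun j hj i _ => ?_, ?_⟩
    · rw [norm_sqrtPullback_of_pos _ _ hy]
      exact (div_le_self (norm_nonneg _) (one_le_pow₀ (Real.one_le_sqrt.2 h1))).trans
        (hmax j (hj.trans hm))
    · have := hB j₀ (by omega) (2 * q) √y
      rw [twoInterpolating_even, pow_mul, pow_mul, sq_abs, Real.sq_sqrt hy.le] at this
      calc _ ≤ (h ^ 2) ^ q * (y ^ q * ‖iteratedDeriv j₀ φ √y‖) := by
            rw [abs_of_pos hy]
            gcongr
        _ ≤ B * M q := this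
        _ ≤ (1 + K) * (B * M q) := le_mul_of_one_le_left (by positivity) (by linarith)
        _ = _ := by ring
  · refine ⟨B, fun j hj i hi => ?_, ?_⟩
    · have : IsFlatBounded (i + 0) B (iteratedDeriv j φ) :=
        IsFlatBounded.iteratedDeriv j (hflat.mono (by omega))
      simpa using norm_sqrtPullback_le i 0 this y
    · have hyq : |y| ^ q ≤ 1 := pow_le_one₀ (abs_nonneg y) (by rw [abs_of_pos hy]; exact h1.le)
      calc h' ^ q * (|y| ^ q * B) ≤ (K * M q) * (1 * B) := by
            gcongr
            exact hgrow q
        _ ≤ B * M q + K * M q * B := by nlinarith [mul_nonneg hB0 hq.le]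
        _ = _ := by ring

/-- The even part of a function. -/
def evenPart : (ℝ → ℂ) →ₗ[ℂ] (ℝ → ℂ) where
  toFun f x := (1 / 2) * (f x + f (-x))
  map_add' f g := by ext x; simp only [Pi.add_apply]; ring
  map_smul' c f := by ext x; simp only [Pi.smul_apply, smul_eq_mul, RingHom.id_apply]; ring

theorem evenPart_neg (f : ℝ → ℂ) (x : ℝ) : evenPart f (-x) = evenPart f x := by
  simp [evenPart, add_comm]

theorem evenPart_eq (f : ℝ → ℂ) :
    evenPart f = (1 / 2 : ℂ) • f + (1 / 2 : ℂ) • fun x => f (-x) := by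
  ext x
  simp [evenPart, mul_add]

theorem norm_iteratedDeriv_evenPart_le {m : ℕ} {f : ℝ → ℂ} (hf : ContDiff ℝ m f) (x : ℝ) :
    ‖iteratedDeriv m (evenPart f) x‖ ≤
      1 / 2 * ‖iteratedDeriv m f x‖ + 1 / 2 * ‖iteratedDeriv m f (-x)‖ := by
  rw [evenPart_eq]
  refine (norm_iteratedDeriv_smul_add_smul_le hf (hf.comp contDiff_neg) _ _ x).trans_eq ?_
  have : iteratedDeriv m (f ∘ fun x => -x) x = (-1 : ℝ) ^ m • iteratedDeriv m f (-x) :=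
    iteratedDeriv_comp_neg m f x
  rw [this]
  simp

/-- Symmetrization is needed because `sqrtPullback` sees only the positive half-line, which
determines the moments only for even functions. -/
theorem restrictsContinuously_evenPart {N : ℕ → ℝ} (hN : ∀ p, 0 < N p) (n : ℕ) {h : ℝ}
    (hh : 0 < h) : RestrictsContinuously evenPart (FlatStep N n h) (FlatStep N n h) := by
  refine restrictsContinuously_gsStep hN hN hh hh (CnFlat_le n) (CnFlat_le n) _ zero_le_one
    fun φ hφ B hB => ⟨⟨?_, fun m hm => ?_⟩, fun m hm p x => ?_⟩
  · rw [evenPart_eq]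
    exact (hφ.1.const_smul (1 / 2 : ℂ)).add ((hφ.1.comp contDiff_neg).const_smul (1 / 2 : ℂ))
  · have := norm_iteratedDeriv_evenPart_le (hφ.1.of_le (by exact_mod_cast hm) : ContDiff ℝ m φ) 0
    simpa [hφ.2 m hm] using this
  · have h1 := norm_iteratedDeriv_evenPart_le (hφ.1.of_le (by exact_mod_cast hm) : ContDiff ℝ m φ) x
    have h2 := hB m hm p x
    have h3 := hB m hm p (-x)
    rw [abs_neg] at h3
    calc _ ≤ h ^ p * (|x| ^ p *
          (1 / 2 * ‖iteratedDeriv m φ x‖ + 1 / 2 * ‖iteratedDeriv m φ (-x)‖)) := by gcongr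
      _ ≤ _ := by linarith

/-! ### Subsequences of even and of odd index -/

theorem norm_seqWeight_le_iff {M : ℕ → ℝ} (hM : ∀ p, 0 < M p) {h : ℝ} (hh : 0 < h)
    (a : (⊤ : Submodule ℂ (ℕ → ℂ))) (p : ℕ) (B : ℝ) :
    ‖seqWeight M h a p‖ ≤ B ↔ h ^ p * ‖a.1 p‖ ≤ B * M p := by
  have hp := hM p
  simp only [seqWeight, LinearMap.coe_mk, AddHom.coe_mk, norm_mul, Complex.norm_real,
    Real.norm_eq_abs, abs_div, abs_pow, abs_of_pos hp, abs_of_pos hh]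
  rw [div_mul_eq_mul_div, div_le_iff₀ hp]

theorem restrictsContinuously_LambdaStep {M N : ℕ → ℝ} (hM : ∀ p, 0 < M p) (hN : ∀ p, 0 < N p)
    {h h' : ℝ} (hh : 0 < h) (hh' : 0 < h') (T : (ℕ → ℂ) →ₗ[ℂ] (ℕ → ℂ)) {C : ℝ} (hC : 0 ≤ C)
    (hT : ∀ a : ℕ → ℂ, ∀ B, 0 ≤ B → (∀ p, h ^ p * ‖a p‖ ≤ B * M p) →
      ∀ p, h' ^ p * ‖T a p‖ ≤ C * B * N p) :
    RestrictsContinuously T (LambdaStep M h) (LambdaStep N h') :=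
  restrictsContinuously_supNormed T hC fun a _ B hB => ⟨trivial, fun j =>
    (norm_seqWeight_le_iff hN hh' _ j _).2 (hT a B ((norm_nonneg _).trans (hB 0))
      (fun p => (norm_seqWeight_le_iff hM hh _ p B).1 (hB p)) j)⟩

/-- `a ↦ (a_{2q})_q`. -/
def evenTerms : (ℕ → ℂ) →ₗ[ℂ] (ℕ → ℂ) := LinearMap.funLeft ℂ ℂ fun q => 2 * q

/-- `a ↦ (a_{2q+1})_q`. -/
def oddTerms : (ℕ → ℂ) →ₗ[ℂ] (ℕ → ℂ) := LinearMap.funLeft ℂ ℂ fun q => 2 * q + 1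

/-- `a ↦ (a_0, 0, a_1, 0, a_2, …)`. -/
def interleaveZero : (ℕ → ℂ) →ₗ[ℂ] (ℕ → ℂ) where
  toFun a p := if Even p then a (p / 2) else 0
  map_add' a b := by ext p; simp only [Pi.add_apply]; split_ifs <;> simp
  map_smul' c a := by ext p; simp

theorem interleaveZero_even (a : ℕ → ℂ) (q : ℕ) : interleaveZero a (2 * q) = a q := by
  simp [interleaveZero]

theorem interleaveZero_odd (a : ℕ → ℂ) (q : ℕ) : interleaveZero a (2 * q + 1) = 0 := by
  simp [interleaveZero]

theorem restrictsContinuously_evenTerms {M : ℕ → ℝ} (hM : IsWeightSequence M) {h h' : ℝ}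
    (hh : 0 < h) (hh' : 0 < h') (hle : h' ≤ h ^ 2) :
    RestrictsContinuously evenTerms (LambdaStep (twoInterpolating M) h) (LambdaStep M h') := by
  refine restrictsContinuously_LambdaStep hM.twoInterpolating.pos hM.pos hh hh' _ zero_le_one
    fun a B _ ha q => ?_
  have := ha (2 * q)
  rw [twoInterpolating_even, pow_mul] at this
  rw [one_mul]
  refine le_trans ?_ this
  change h' ^ q * ‖a (2 * q)‖ ≤ _
  gcongr

/-- By (dc), $N_{2q+1}$ is at most $CH^{2q+1}M_q$. The factor $H^{2q}$ turns $h$ into $h/H$; the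
remaining $H$ and the unused $h$ give the constant $CH/h$. -/
theorem restrictsContinuously_oddTerms {M : ℕ → ℝ} (hM : IsWeightSequence M) {C H : ℝ}
    (hC : 1 ≤ C) (hH : 1 ≤ H)
    (hdc : ∀ p, twoInterpolating M (p + 1) ≤ C * H ^ (p + 1) * twoInterpolating M p)
    {h h' : ℝ} (hh : 0 < h) (hh' : 0 < h') (hle : h' ≤ (h / H) ^ 2) :
    RestrictsContinuously oddTerms (LambdaStep (twoInterpolating M) h) (LambdaStep M h') := by
  refine restrictsContinuously_LambdaStep hM.twoInterpolating.pos hM.pos hh hh' _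
    (C := C * (H / h)) (by positivity) fun a B hB ha q => ?_
  have h1 := (ha (2 * q + 1)).trans (mul_le_mul_of_nonneg_left (hdc (2 * q)) hB)
  rw [twoInterpolating_even] at h1
  change h' ^ q * ‖a (2 * q + 1)‖ ≤ _
  calc h' ^ q * ‖a (2 * q + 1)‖ ≤ ((h / H) ^ 2) ^ q * ‖a (2 * q + 1)‖ := by gcongr
    _ = (h ^ (2 * q + 1) * ‖a (2 * q + 1)‖) / (h * H ^ (2 * q)) := by
        rw [← pow_mul, div_pow]
        field_simp
        ring
    _ ≤ (B * (C * H ^ (2 * q + 1) * M q)) / (h * H ^ (2 * q)) := by gcongr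
    _ = _ := by
        field_simp
        ring

theorem restrictsContinuously_interleaveZero {M : ℕ → ℝ} (hM : IsWeightSequence M) {h h' : ℝ}
    (hh : 0 < h) (hh' : 0 < h') (hle : h' ^ 2 ≤ h) :
    RestrictsContinuously interleaveZero (LambdaStep M h)
      (LambdaStep (twoInterpolating M) h') := by
  refine restrictsContinuously_LambdaStep hM.pos hM.twoInterpolating.pos hh hh' _ zero_le_one
    fun a B hB ha p => ?_
  obtain ⟨q, rfl | rfl⟩ := Nat.even_or_odd' p
  · rw [interleaveZero_even, twoInterpolating_even, one_mul, pow_mul]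
    refine le_trans ?_ (ha q)
    gcongr
  · have := hM.twoInterpolating.pos (2 * q + 1)
    rw [interleaveZero_odd, norm_zero, mul_zero]
    positivity

/-! ### Moments -/

theorem integral_of_even {g : ℝ → ℂ} (hg : Integrable g) (he : ∀ x, g (-x) = g x) :
    ∫ x, g x = 2 * ∫ x in Set.Ioi 0, g x := by
  have h1 : ∫ x in Set.Iic 0, g x = ∫ x in Set.Ioi 0, g x := by
    have := integral_comp_neg_Iic (0 : ℝ) g
    simpa [he] using this
  rw [← intervalIntegral.integral_Iic_add_Ioi (b := 0) hg.integrableOn hg.integrableOn, h1,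
    two_mul]

/-- No integrability is required: reflection preserves the integral, including its default value
$0$. -/
theorem integral_of_odd {g : ℝ → ℂ} (ho : ∀ x, g (-x) = -g x) : ∫ x, g x = 0 := by
  have h := integral_neg_eq_self g volume
  simp only [ho, integral_neg] at h
  exact self_eq_neg.1 h.symm

theorem integral_Ioi_comp_sq (g : ℝ → ℂ) :
    ∫ x in Set.Ioi (0 : ℝ), (2 * x : ℂ) * g (x ^ 2) = ∫ y in Set.Ioi 0, g y := by
  rw [← integral_comp_rpow_Ioi_of_pos (g := g) two_pos]
  refine setIntegral_congr_fun measurableSet_Ioi fun x _ => ?_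
  norm_num

theorem moment_eq_setIntegral_Ioi {φ : ℝ → ℂ} (h0 : ∀ y ≤ 0, φ y = 0) (q : ℕ) :
    moment φ q = ∫ y in Set.Ioi (0 : ℝ), (y : ℂ) ^ q * φ y :=
  (setIntegral_eq_integral_of_forall_compl_eq_zero fun y hy => by
    rw [h0 y (not_lt.1 hy), mul_zero]).symm

/-- The integrand is $x^{2q+1}\operatorname{sgn}(x)\varphi(x^2)$, which is even; doubling the
half-line integral supplies the Jacobian $2x$. -/
theorem moment_signSquare_of_odd {φ : ℝ → ℂ} (h0 : ∀ y ≤ 0, φ y = 0) {k p q : ℕ}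
    (hint : Integrable fun x : ℝ => (x : ℂ) ^ p * signSquare k φ x) (h : p + k = 2 * q + 1) :
    moment (signSquare k φ) p = moment φ q := by
  have hodd : Odd (p + k) := ⟨q, h⟩
  rw [moment, integral_of_even hint, moment_eq_setIntegral_Ioi h0,
    ← integral_Ioi_comp_sq fun y => (y : ℂ) ^ q * φ y, ← integral_const_mul]
  · refine setIntegral_congr_fun measurableSet_Ioi fun x hx => ?_
    simp only [signSquare_apply, if_pos (le_of_lt (Set.mem_Ioi.1 hx))]
    rw [← mul_assoc ((x : ℂ) ^ p), ← pow_add, h]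
    push_cast
    ring
  · intro x
    simp only [signSquare_apply]
    rw [← mul_assoc, ← mul_assoc, ← pow_add, ← pow_add]
    push_cast
    rw [hodd.neg_pow, neg_sq]
    rcases lt_trichotomy x 0 with hx | rfl | hx
    · rw [if_pos (by linarith), if_neg (by linarith)]; ring
    · simp [h0 0 le_rfl]
    · rw [if_neg (by linarith), if_pos (by linarith)]; ring

theorem moment_signSquare_of_even {φ : ℝ → ℂ} (h0 : φ 0 = 0) {k p : ℕ}
    (h : Even (p + k)) : moment (signSquare k φ) p = 0 := by
  refine integral_of_odd fun x => ?_
  simp only [signSquare_apply]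
  rw [← mul_assoc, ← mul_assoc, ← pow_add, ← pow_add]
  push_cast
  rw [h.neg_pow, neg_sq]
  rcases lt_trichotomy x 0 with hx | rfl | hx
  · rw [if_pos (by linarith), if_neg (by linarith)]; ring
  · simp [h0]
  · rw [if_neg (by linarith), if_pos (by linarith)]; ring

/-- The factor $1/\sqrt y$ cancels the $x$ in $dy=2x\,dx$, and the remaining $2$ extends the
integral to the whole line by evenness. -/
theorem moment_sqrtPullback {f : ℝ → ℂ} (he : ∀ x, f (-x) = f x) {q : ℕ}
    (hint : Integrable fun x : ℝ => (x : ℂ) ^ (2 * q) * f x) :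
    moment (sqrtPullback 1 f) q = moment f (2 * q) := by
  rw [moment_eq_setIntegral_Ioi fun y hy => sqrtPullback_of_nonpos 1 f hy, moment,
    integral_of_even hint fun x => by
      rw [he]
      push_cast
      rw [(even_two_mul q).neg_pow], 
    ← integral_Ioi_comp_sq fun y => (y : ℂ) ^ q * sqrtPullback 1 f y, ← integral_const_mul]
  refine setIntegral_congr_fun measurableSet_Ioi fun x hx => ?_
  have hx' : (x : ℂ) ≠ 0 := by exact_mod_cast (ne_of_gt hx)
  rw [sqrtPullback_of_pos 1 f (pow_pos hx 2), Real.sqrt_sq (le_of_lt (Set.mem_Ioi.1 hx))]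
  push_cast
  field_simp
  ring

theorem moment_evenPart {f : ℝ → ℂ} {q : ℕ}
    (hint : Integrable fun x : ℝ => (x : ℂ) ^ (2 * q) * f x) :
    moment (evenPart f) (2 * q) = moment f (2 * q) := by
  have hint' := hint.comp_neg
  have hneg := integral_neg_eq_self (fun x : ℝ => (x : ℂ) ^ (2 * q) * f x) volume
  have e : ∀ x : ℝ, (x : ℂ) ^ (2 * q) * evenPart f x =
      1 / 2 * ((x : ℂ) ^ (2 * q) * f x + ((-x : ℝ) : ℂ) ^ (2 * q) * f (-x)) := fun x => by
    push_cast
    rw [(even_two_mul q).neg_pow]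
    simp only [evenPart, LinearMap.coe_mk, AddHom.coe_mk]
    ring
  simp only [moment, e]
  rw [integral_const_mul, integral_add hint hint', hneg]
  ring

/-! ### Transfer between the two moment problems -/

theorem moment_add_of_integrable {φ ψ : ℝ → ℂ} {p : ℕ}
    (hφ : Integrable fun x : ℝ => (x : ℂ) ^ p * φ x)
    (hψ : Integrable fun x : ℝ => (x : ℂ) ^ p * ψ x) :
    moment (φ + ψ) p = moment φ p + moment ψ p := by
  simp only [moment, Pi.add_apply, mul_add]
  exact integral_add hφ hψ

/-- The power $k=1$ is paired with the even terms and $k=0$ with the odd ones; each contributes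
nothing to the moments of the other parity. -/
theorem momentMap_transfer_half_flat {E E' : TopSubspace (ℝ → ℂ)} {F F' : TopSubspace (ℕ → ℂ)}
    (hE : E.carrier ≤ momentDomain F.carrier) (hE' : E'.carrier ≤ momentDomain F'.carrier)
    (hadd : @ContinuousAdd _ E'.top _) (hhalf : E.carrier ≤ CnHalf 0)
    (hS : ∀ k, RestrictsContinuously (signSquare k) E E')
    (heven : RestrictsContinuously evenTerms F' F) (hodd : RestrictsContinuously oddTerms F' F) :
    (Function.Surjective (momentMap E F hE) → Function.Surjective (momentMap E' F' hE')) ∧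
    (HasContinuousLinearRightInverse (momentMap E F hE) →
      HasContinuousLinearRightInverse (momentMap E' F' hE')) := by
  refine momentMap_transfer hE hE' hadd (hS 1) (hS 0) heven hodd
    fun φ₀ hφ₀ φ₁ hφ₁ a h₀ h₁ => funext fun p => ?_
  have z : ∀ φ ∈ E.carrier, ∀ y ≤ 0, φ y = 0 := fun φ hφ y hy => by
    simpa using iteratedDeriv_eq_zero_of_mem_CnHalf (hhalf hφ) le_rfl hy
  have i₀ := (hE' ((hS 1).1 φ₀ hφ₀)).1
  have i₁ := (hE' ((hS 0).1 φ₁ hφ₁)).1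
  rw [moment_add_of_integrable (i₀ p) (i₁ p)]
  obtain ⟨q, rfl | rfl⟩ := Nat.even_or_odd' p
  · rw [moment_signSquare_of_odd (z φ₀ hφ₀) (i₀ _) rfl,
      moment_signSquare_of_even (z φ₁ hφ₁ 0 le_rfl) (even_two_mul q), h₀, add_zero]
    rfl
  · rw [moment_signSquare_of_even (z φ₀ hφ₀ 0 le_rfl) ⟨q + 1, by ring⟩,
      moment_signSquare_of_odd (z φ₁ hφ₁) (i₁ _) rfl, h₁, zero_add]
    rfl

theorem momentMap_transfer_flat_half {E E' : TopSubspace (ℝ → ℂ)} {F F' : TopSubspace (ℕ → ℂ)}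
    (hE : E.carrier ≤ momentDomain F.carrier) (hE' : E'.carrier ≤ momentDomain F'.carrier)
    (hadd : @ContinuousAdd _ E'.top _) (hsym : RestrictsContinuously evenPart E E)
    (hS : RestrictsContinuously (sqrtPullback 1) E E')
    (hinter : RestrictsContinuously interleaveZero F' F) :
    (Function.Surjective (momentMap E F hE) → Function.Surjective (momentMap E' F' hE')) ∧
    (HasContinuousLinearRightInverse (momentMap E F hE) →
      HasContinuousLinearRightInverse (momentMap E' F' hE')) := by
  refine momentMap_transfer hE hE' hadd (hS.comp hsym) (.zero E E') hinter (.zero F' F)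
    fun φ hφ _ _ a h₀ _ => funext fun q => ?_
  have i₀ := (hE (hsym.1 φ hφ)).1
  rw [LinearMap.zero_apply, add_zero, LinearMap.comp_apply,
    moment_sqrtPullback (evenPart_neg φ) (i₀ _), moment_evenPart ((hE hφ).1 _), h₀,
    interleaveZero_even]

/-! ### Continuity on the Beurling and Roumieu limits -/

variable {M : ℕ → ℝ}

theorem restrictsContinuously_evenTerms_beurling (hM : IsWeightSequence M) :
    RestrictsContinuously evenTerms (LambdaBeurling (twoInterpolating M)) (LambdaBeurling M) :=
  .projLim fun n => ⟨n, restrictsContinuously_evenTerms hM (by positivity) (by positivity)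
    (by nlinarith [(Nat.cast_nonneg n : (0 : ℝ) ≤ n)])⟩

theorem restrictsContinuously_oddTerms_beurling (hM : IsWeightSequence M)
    (hdc : DerivationClosed M) :
    RestrictsContinuously oddTerms (LambdaBeurling (twoInterpolating M)) (LambdaBeurling M) := by
  obtain ⟨C, H, hC, hH, hdc⟩ := hdc.twoInterpolating hM
  refine .projLim fun n => ?_
  obtain ⟨k, hk⟩ := exists_nat_ge (((n : ℝ) + 1) * H)
  have hn : (0 : ℝ) ≤ n := Nat.cast_nonneg n
  refine ⟨k, restrictsContinuously_oddTerms hM hC hH hdc (by positivity) (by positivity) ?_⟩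
  have h1 : (n : ℝ) + 1 ≤ (k + 1) / H := by
    rw [le_div_iff₀ (by positivity)]
    linarith
  nlinarith

theorem restrictsContinuously_interleaveZero_beurling (hM : IsWeightSequence M) :
    RestrictsContinuously interleaveZero (LambdaBeurling M)
      (LambdaBeurling (twoInterpolating M)) := by
  refine .projLim fun n => ?_
  obtain ⟨k, hk⟩ := exists_nat_ge (((n : ℝ) + 1) ^ 2)
  exact ⟨k, restrictsContinuously_interleaveZero hM (by positivity) (by positivity)
    (by linarith)⟩

theorem restrictsContinuously_evenTerms_roumieu (hM : IsWeightSequence M) :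
    RestrictsContinuously evenTerms (LambdaRoumieu (twoInterpolating M)) (LambdaRoumieu M) :=
  .indLim fun ⟨h, hh⟩ => ⟨⟨h ^ 2, Set.mem_Ioi.2 (pow_pos hh 2)⟩,
    restrictsContinuously_evenTerms hM hh (pow_pos hh 2) le_rfl⟩

theorem restrictsContinuously_oddTerms_roumieu (hM : IsWeightSequence M)
    (hdc : DerivationClosed M) :
    RestrictsContinuously oddTerms (LambdaRoumieu (twoInterpolating M)) (LambdaRoumieu M) := by
  obtain ⟨C, H, hC, hH, hdc⟩ := hdc.twoInterpolating hM
  refine .indLim fun ⟨h, hh⟩ => ?_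
  have hpos : 0 < (h / H) ^ 2 := pow_pos (div_pos hh (by linarith)) 2
  exact ⟨⟨(h / H) ^ 2, hpos⟩, restrictsContinuously_oddTerms hM hC hH hdc hh hpos le_rfl⟩

theorem restrictsContinuously_interleaveZero_roumieu (hM : IsWeightSequence M) :
    RestrictsContinuously interleaveZero (LambdaRoumieu M)
      (LambdaRoumieu (twoInterpolating M)) :=
  .indLim fun ⟨h, hh⟩ => ⟨⟨√h, Real.sqrt_pos.2 hh⟩,
    restrictsContinuously_interleaveZero hM hh (Real.sqrt_pos.2 hh)
      (Real.sq_sqrt (le_of_lt hh)).le⟩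

theorem restrictsContinuously_signSquare_beurling (hM : IsWeightSequence M)
    (hdc : DerivationClosed M) (k : ℕ) :
    RestrictsContinuously (signSquare k) (HalfBeurling M) (FlatBeurling (twoInterpolating M)) := by
  obtain ⟨C, H, hC, hH, hdc⟩ := hdc.twoInterpolating hM
  refine .projLim fun n => ?_
  obtain ⟨l, hl⟩ := exists_nat_ge ((((n : ℝ) + 1) * H ^ (k + (n + 1))) ^ 2)
  -- The same index fixes the weight parameter and the number of derivatives, so it must dominate
  -- both requirements.
  refine ⟨max l n, ?_⟩
  refine restrictsContinuously_signSquare hM hC hH hdc k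
    (Nat.succ_le_succ (le_max_right l n)) (by positivity) (hl.trans ?_)
  have : (l : ℝ) ≤ (max l n : ℕ) := by exact_mod_cast le_max_left l n
  linarith

/-- The loss $H^{k+n}$ depends on $n$; this is allowed because $h$ is chosen after $n$. -/
theorem restrictsContinuously_signSquare_plb (hM : IsWeightSequence M)
    (hdc : DerivationClosed M) (k : ℕ) :
    RestrictsContinuously (signSquare k) (HalfRoumieuPLB M)
      (FlatRoumieuPLB (twoInterpolating M)) := by
  obtain ⟨C, H, hC, hH, hdc⟩ := hdc.twoInterpolating hM
  refine .projLim fun n => ⟨n, .indLim fun ⟨h, hh⟩ => ?_⟩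
  have hh : 0 < h := hh
  have hpos : 0 < √h / H ^ (k + n) := by positivity
  refine ⟨⟨√h / H ^ (k + n), hpos⟩,
    restrictsContinuously_signSquare hM hC hH hdc k le_rfl hpos ?_⟩
  rw [div_mul_cancel₀ _ (by positivity), Real.sq_sqrt hh.le]

theorem restrictsContinuously_sqrtPullback_beurling (hM : IsWeightSequence M) :
    RestrictsContinuously (sqrtPullback 1) (FlatBeurling (twoInterpolating M))
      (HalfBeurling M) := by
  -- Index $n$ stands for order $n+1$, so $3(n+1)+5=(3n+7)+1$.
  refine .projLim fun n => ⟨3 * n + 7, restrictsContinuously_sqrtPullback hM (by omega)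
    (by positivity) (by positivity) ?_⟩
  push_cast
  nlinarith [(Nat.cast_nonneg n : (0 : ℝ) ≤ n)]

/-- The new parameter $h^2$ does not involve $n$, so it can be fixed before the inner projective
limit. -/
theorem restrictsContinuously_sqrtPullback_lf (hM : IsWeightSequence M) :
    RestrictsContinuously (sqrtPullback 1) (FlatRoumieuLF (twoInterpolating M))
      (HalfRoumieuLF M) :=
  .indLim fun ⟨h, hh⟩ => ⟨⟨h ^ 2, Set.mem_Ioi.2 (pow_pos hh 2)⟩, .projLim fun n => ⟨3 * n + 5,
    restrictsContinuously_sqrtPullback hM le_rfl hh (pow_pos hh 2) le_rfl⟩⟩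

theorem restrictsContinuously_evenPart_beurling {N : ℕ → ℝ} (hN : IsWeightSequence N) :
    RestrictsContinuously evenPart (FlatBeurling N) (FlatBeurling N) :=
  .projLim fun n => ⟨n, restrictsContinuously_evenPart hN.pos _ (by positivity)⟩

theorem restrictsContinuously_evenPart_lf {N : ℕ → ℝ} (hN : IsWeightSequence N) :
    RestrictsContinuously evenPart (FlatRoumieuLF N) (FlatRoumieuLF N) :=
  .indLim fun h => ⟨h, .projLim fun n => ⟨n, restrictsContinuously_evenPart hN.pos _ h.2⟩⟩

theorem CnHalf_anti {m n : ℕ} (h : m ≤ n) : CnHalf n ≤ CnHalf m :=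
  fun _ hφ => ⟨hφ.1.of_le (by exact_mod_cast h), hφ.2⟩

theorem HalfStep_le_CnHalf (M : ℕ → ℝ) (n : ℕ) (h : ℝ) : (HalfStep M n h).carrier ≤ CnHalf n :=
  fun _ hφ => hφ.1

theorem HalfBeurling_le_CnHalf (M : ℕ → ℝ) : (HalfBeurling M).carrier ≤ CnHalf 0 :=
  (iInf_le _ 0).trans ((HalfStep_le_CnHalf M _ _).trans (CnHalf_anti (Nat.zero_le _)))

theorem HalfRoumieuPLB_le_CnHalf (M : ℕ → ℝ) : (HalfRoumieuPLB M).carrier ≤ CnHalf 0 :=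
  (iInf_le _ 0).trans (iSup_le fun h => HalfStep_le_CnHalf M 0 h)

end

theorem mainTheorem5 (M : ℕ → ℝ) (hM : IsWeightSequence M) (hlc : LogConvex M)
    (hdc : DerivationClosed M) :
    -- (a) Beurling case
    ((Function.Surjective
        (momentMap (HalfBeurling M) (LambdaBeurling M) (halfBeurling_le hM hdc)) ↔
      Function.Surjective
        (momentMap (FlatBeurling (twoInterpolating M)) (LambdaBeurling (twoInterpolating M))
          (flatBeurling_le hM.twoInterpolating (hdc.twoInterpolating hM)))) ∧
     (HasContinuousLinearRightInverse
        (momentMap (HalfBeurling M) (LambdaBeurling M) (halfBeurling_le hM hdc)) ↔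
      HasContinuousLinearRightInverse
        (momentMap (FlatBeurling (twoInterpolating M)) (LambdaBeurling (twoInterpolating M))
          (flatBeurling_le hM.twoInterpolating (hdc.twoInterpolating hM))))) ∧
    -- (b) Roumieu case, (LF)-spaces
    ((Function.Surjective
        (momentMap (FlatRoumieuLF (twoInterpolating M)) (LambdaRoumieu (twoInterpolating M))
          (flatRoumieuLF_le hM.twoInterpolating (hdc.twoInterpolating hM))) →
      Function.Surjective
        (momentMap (HalfRoumieuLF M) (LambdaRoumieu M) (halfRoumieuLF_le hM hdc))) ∧
     (HasContinuousLinearRightInverse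
        (momentMap (FlatRoumieuLF (twoInterpolating M)) (LambdaRoumieu (twoInterpolating M))
          (flatRoumieuLF_le hM.twoInterpolating (hdc.twoInterpolating hM))) →
      HasContinuousLinearRightInverse
        (momentMap (HalfRoumieuLF M) (LambdaRoumieu M) (halfRoumieuLF_le hM hdc)))) ∧
    -- (c) Roumieu case, (PLB)-spaces
    ((Function.Surjective
        (momentMap (HalfRoumieuPLB M) (LambdaRoumieu M) (halfRoumieuPLB_le hM hdc)) →
      Function.Surjective
        (momentMap (FlatRoumieuPLB (twoInterpolating M)) (LambdaRoumieu (twoInterpolating M))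
          (flatRoumieuPLB_le hM.twoInterpolating (hdc.twoInterpolating hM)))) ∧
     (HasContinuousLinearRightInverse
        (momentMap (HalfRoumieuPLB M) (LambdaRoumieu M) (halfRoumieuPLB_le hM hdc)) →
      HasContinuousLinearRightInverse
        (momentMap (FlatRoumieuPLB (twoInterpolating M)) (LambdaRoumieu (twoInterpolating M))
          (flatRoumieuPLB_le hM.twoInterpolating (hdc.twoInterpolating hM))))) := by
  have hN := hM.twoInterpolating
  have hF := momentMap_transfer_half_flat (halfBeurling_le hM hdc)
    (flatBeurling_le hN (hdc.twoInterpolating hM))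
    (TopSubspace.continuousAdd_projLim fun _ => TopSubspace.continuousAdd_supNormed _ _)
    (HalfBeurling_le_CnHalf M) (restrictsContinuously_signSquare_beurling hM hdc)
    (restrictsContinuously_evenTerms_beurling hM)
    (restrictsContinuously_oddTerms_beurling hM hdc)
  have hH := momentMap_transfer_flat_half (flatBeurling_le hN (hdc.twoInterpolating hM))
    (halfBeurling_le hM hdc)
    (TopSubspace.continuousAdd_projLim fun _ => TopSubspace.continuousAdd_supNormed _ _)
    (restrictsContinuously_evenPart_beurling hN) (restrictsContinuously_sqrtPullback_beurling hM)
    (restrictsContinuously_interleaveZero_beurling hM)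
  refine ⟨⟨⟨hF.1, hH.1⟩, ⟨hF.2, hH.2⟩⟩, ?_, ?_⟩
  · exact momentMap_transfer_flat_half _ _ (TopSubspace.continuousAdd_indLim _)
      (restrictsContinuously_evenPart_lf hN) (restrictsContinuously_sqrtPullback_lf hM)
      (restrictsContinuously_interleaveZero_roumieu hM)
  · exact momentMap_transfer_half_flat _ _
      (TopSubspace.continuousAdd_projLim fun _ => TopSubspace.continuousAdd_indLim _)
      (HalfRoumieuPLB_le_CnHalf M) (restrictsContinuously_signSquare_plb hM hdc)
      (restrictsContinuously_evenTerms_roumieu hM)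
      (restrictsContinuously_oddTerms_roumieu hM hdc)
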